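/- In this statement digraphs are labelled, may have loops (a loop contributes $1$ to the in-degree and $1$ to the out-degree of its vertex) and have no multiple arcs. For positive integers $n,m$ let $\mathcal G_{1,1}(n,m)$ be the set of digraphs on the vertex set $\{1,\dots,n\}$ with exactly $m$ arcs in which every in-degree and every out-degree is at least $1$. For every real $c>1$ the equation $$c=\frac{\lambda e^{\lambda}}{e^{\lambda}-1}$$ has a unique positive root $\lambda=\lambda(c)$. As $n\to\infty$, uniformly for $m=O(n\log n)$ and $m-n\to\infty$, $$|\mathcal G_{1,1}(n,m)|\sim \frac{m!\,(e^{\lambda}-1)^{2n}}{2\pi n c(1+\lambda-c)\lambda^{2m}}\exp(-\lambda^2/2),\qquad c=\frac mn,\ \lambda=\lambda(c).$$ That is: for all real $C>0$ and $\varepsilon>0$ there are $N$ and $R$ such that for all integers $n\ge N$ and $m$ with $n+R\le m\le Cn\log n$ (and $m>n$, so that $c>1$) the quotient of the left side by the right side differs from $1$ by less than $\varepsilon$. -/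

import Mathlib

namespace Dicore

/-- The set of arcs of a digraph (loops are allowed, multiple arcs are not). -/
def arcs {V : Type*} (G : Digraph V) : Set (V × V) := {p | G.Adj p.1 p.2}

/-- The out-degree of a vertex; a loop counts once. -/
noncomputable def outdeg {V : Type*} (G : Digraph V) (v : V) : ℕ := {w | G.Adj v w}.ncard

/-- The in-degree of a vertex; a loop counts once. -/
noncomputable def indeg {V : Type*} (G : Digraph V) (v : V) : ℕ := {u | G.Adj u v}.ncard

/-- The set of digraphs on `n` labelled vertices with `m` arcs
in which all in-degrees and out-degrees are at least `1`. -/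
def dicores (n m : ℕ) : Set (Digraph (Fin n)) :=
  {G | (arcs G).ncard = m ∧ ∀ v, 1 ≤ outdeg G v ∧ 1 ≤ indeg G v}

/-- `lam` is a positive root of `c = lam * e ^ lam / (e ^ lam - 1)`. -/
def IsParam (c lam : ℝ) : Prop :=
  0 < lam ∧ c = lam * Real.exp lam / (Real.exp lam - 1)

/-- The asymptotic formula for the number of dicores, with `c = m / n`. -/
noncomputable def formula (n m : ℕ) (lam : ℝ) : ℝ :=
  let c : ℝ := (m : ℝ) / n
  (m.factorial : ℝ) * (Real.exp lam - 1) ^ (2 * n) /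
      (2 * Real.pi * n * c * (1 + lam - c) * lam ^ (2 * m)) *
    Real.exp (-lam ^ 2 / 2)

end Dicore

/-!
Inclusion–exclusion over the vertices without out-arcs or without in-arcs, followed by the expansion
of the falling factorial in powers, gives
`m! * #(dicores n m) = ∑ j, fallCoeff m j * altSum n (m - j) ^ 2`.
On the circle of radius `lam`, Cauchy's formula writes each alternating sum as a Fourier integral
of the `n`-th power of the characteristic function `chi lam` of the zero-truncated Poisson
distribution, and the sum over `j` collapses into `simpleFactor m (lam ^ 2 * exp (i * (φ + ψ)))`
under a double integral. The choice of `lam` makes `c` the mean of that distribution, so a local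
limit theorem evaluates the remaining integrals of `chi lam φ ^ n`. Since `m ^ j * (m - j)! / m!` is
a negative moment of a Gamma distribution, `simpleFactor m z` is a twofold Gamma average of
`∏ i < m, (1 - i * z / m ^ 2)`, hence close to `exp (-lam ^ 2 / 2)` when `z` is close to `lam ^ 2`.
All relative errors are of order `(1 + lam) ^ 4 / (n * lam) ^ (1 / 4)`, which is small once `m - n`
exceeds a large multiple of `(m / n) ^ 16`.
-/

namespace Dicore

/-! ### Inclusion–exclusion -/

section Counting

open Finset

/-- The alternating sum `∑ i, (-1) ^ (n - i) * choose n i * i ^ k`, which counts surjections from a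
`k`-element set onto an `n`-element set. -/
noncomputable def altSum (n k : ℕ) : ℂ :=
  ∑ i ∈ range (n + 1), (-1) ^ (n - i) * (n.choose i : ℂ) * (i : ℂ) ^ k

/-- The coefficients of the falling factorial:
`∏ l < m, (x - l) = ∑ j, fallCoeff m j * x ^ (m - j)`. -/
noncomputable def fallCoeff (m j : ℕ) : ℂ :=
  ∑ t ∈ powersetCard j (range m), ∏ i ∈ t, (-(i : ℂ))

open scoped Classical in
/-- The relations with `m` elements between `V` and `W` whose two projections are onto; for `V = W`
these are the arc sets of dicores. -/
noncomputable def coverSets (V W : Type*) [Fintype V] [Fintype W] (m : ℕ) :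
    Finset (Finset (V × W)) :=
  (powersetCard m univ).filter fun S => (∀ v, ∃ w, (v, w) ∈ S) ∧ ∀ w, ∃ v, (v, w) ∈ S

theorem one_le_outdeg_iff {V : Type*} [Finite V] {G : Digraph V} {v : V} :
    1 ≤ outdeg G v ↔ ∃ w, G.Adj v w :=
  Set.ncard_pos

theorem one_le_indeg_iff {V : Type*} [Finite V] {G : Digraph V} {v : V} :
    1 ≤ indeg G v ↔ ∃ u, G.Adj u v :=
  Set.ncard_pos

theorem ncard_dicores (n m : ℕ) : (dicores n m).ncard = #(coverSets (Fin n) (Fin n) m) := by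
  classical
  rw [← Set.ncard_coe_finset]
  refine (Set.ncard_congr (fun S _ => ⟨fun u v => (u, v) ∈ S⟩) ?_ ?_ ?_).symm
  · intro S hS
    simp only [coverSets, coe_filter, mem_powersetCard_univ, Set.mem_ofPred_eq] at hS
    refine ⟨?_, fun v => ⟨one_le_outdeg_iff.2 (hS.2.1 v), one_le_indeg_iff.2 (hS.2.2 v)⟩⟩
    rw [← hS.1, ← Set.ncard_coe_finset]
    rfl
  · intro S T _ _ h
    ext ⟨u, v⟩
    exact iff_of_eq (congrArg (fun G : Digraph (Fin n) => G.Adj u v) h)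
  · rintro G ⟨hcard, hdeg⟩
    refine ⟨univ.filter fun p => G.Adj p.1 p.2, ?_, by ext; simp⟩
    simp only [coverSets, coe_filter, mem_powersetCard_univ, Set.mem_ofPred_eq, mem_filter,
      mem_univ, true_and]
    refine ⟨?_, fun v => one_le_outdeg_iff.1 (hdeg v).1, fun v => one_le_indeg_iff.1 (hdeg v).2⟩
    rw [← hcard, ← Set.ncard_coe_finset]
    simp [arcs]

theorem ite_forall_eq_sum {V R : Type*} [Fintype V] [CommRing R] (p : V → Prop)
    [Decidable (∀ v, p v)] [∀ A : Finset V, Decidable (∀ v ∈ A, ¬ p v)] :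
    (if ∀ v, p v then (1 : R) else 0) =
      ∑ A : Finset V, (-1) ^ #A * if ∀ v ∈ A, ¬ p v then (1 : R) else 0 := by
  classical
  calc (if ∀ v, p v then (1 : R) else 0) = ∏ v, if p v then (1 : R) else 0 := by
        simp [prod_ite_zero]
    _ = ∏ v, (1 + -(if ¬ p v then (1 : R) else 0)) :=
        prod_congr rfl fun v _ => by split_ifs <;> simp_all
    _ = _ := by
        rw [prod_one_add, powerset_univ]
        exact sum_congr rfl fun A _ => by rw [prod_neg, prod_ite_zero, prod_const_one]; congr

open scoped Classical in
theorem card_filter_forall_notMem {V W : Type*} [Fintype V] [Fintype W] (m : ℕ)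
    (A : Finset V) (B : Finset W) :
    #{S ∈ powersetCard m (univ : Finset (V × W)) |
        (∀ v ∈ A, ¬ ∃ w, (v, w) ∈ S) ∧ ∀ w ∈ B, ¬ ∃ v, (v, w) ∈ S} =
      ((Fintype.card V - #A) * (Fintype.card W - #B)).choose m := by
  rw [← card_compl, ← card_compl, ← card_product, ← card_powersetCard]
  congr 1
  ext S
  simp only [mem_filter, mem_powersetCard, subset_iff, mem_product, mem_compl, Prod.forall]
  grind

theorem card_coverSets {V W R : Type*} [Fintype V] [Fintype W] [CommRing R] (m : ℕ) :
    (#(coverSets V W m) : R) = ∑ A : Finset V, ∑ B : Finset W, (-1) ^ #A * (-1) ^ #B *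
      (((Fintype.card V - #A) * (Fintype.card W - #B)).choose m : R) := by
  classical
  have indicator_eq : ∀ S : Finset (V × W),
      (if (∀ v, ∃ w, (v, w) ∈ S) ∧ ∀ w, ∃ v, (v, w) ∈ S then (1 : R) else 0) =
      ∑ A : Finset V, ∑ B : Finset W, (-1) ^ #A * (-1) ^ #B *
        if (∀ v ∈ A, ¬ ∃ w, (v, w) ∈ S) ∧ ∀ w ∈ B, ¬ ∃ v, (v, w) ∈ S then (1 : R) else 0 := by
    intro S
    rw [← mul_one (1 : R), ← ite_zero_mul_ite_zero, mul_one,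
      ite_forall_eq_sum fun v => ∃ w, (v, w) ∈ S, ite_forall_eq_sum fun w => ∃ v, (v, w) ∈ S,
      sum_mul_sum]
    refine sum_congr rfl fun A _ => sum_congr rfl fun B _ => ?_
    rw [mul_mul_mul_comm, ite_zero_mul_ite_zero, mul_one]
  rw [coverSets, card_filter]
  push_cast
  simp_rw [indicator_eq]
  rw [sum_comm]
  refine sum_congr rfl fun A _ => ?_
  rw [sum_comm]
  refine sum_congr rfl fun B _ => ?_
  rw [← mul_sum, sum_boole, card_filter_forall_notMem]

theorem sum_card_compl_pow_eq_altSum (V : Type*) [Fintype V] (k : ℕ) :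
    ∑ A : Finset V, (-1) ^ #A * ((Fintype.card V - #A : ℕ) : ℂ) ^ k =
      altSum (Fintype.card V) k := by
  rw [← powerset_univ,
    sum_powerset_apply_card fun a => (-1 : ℂ) ^ a * ((Fintype.card V - a : ℕ) : ℂ) ^ k,
    card_univ, ← sum_range_reflect, altSum]
  refine sum_congr rfl fun i hi => ?_
  have hi' : i ≤ Fintype.card V := by simpa [Nat.lt_succ_iff] using hi
  rw [add_tsub_cancel_right, Nat.choose_symm hi', Nat.sub_sub_self hi', nsmul_eq_mul]
  ring

theorem prod_sub_mul_eq_sum_fallCoeff (m : ℕ) (x y : ℂ) :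
    ∏ i ∈ range m, (x - i * y) = ∑ j ∈ range (m + 1), fallCoeff m j * y ^ j * x ^ (m - j) := by
  simp_rw [fun i : ℕ => show x - i * y = -(i : ℂ) * y + x by ring]
  rw [prod_add, sum_powerset, card_range]
  refine sum_congr rfl fun j _ => ?_
  rw [fallCoeff, sum_mul, sum_mul]
  refine sum_congr rfl fun t ht => ?_
  rw [mem_powersetCard] at ht
  rw [prod_mul_distrib, prod_const, prod_const, ht.2, card_sdiff_of_subset ht.1, ht.2, card_range]

theorem factorial_mul_choose_eq_sum (m a : ℕ) : (m.factorial : ℂ) * (a.choose m : ℂ) =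
    ∑ j ∈ range (m + 1), fallCoeff m j * (a : ℂ) ^ (m - j) := by
  have h := prod_sub_mul_eq_sum_fallCoeff m a 1
  simp only [mul_one, one_pow] at h
  rw [← h, ← descPochhammer_eval_eq_prod_range, descPochhammer_eval_eq_descFactorial,
    Nat.descFactorial_eq_factorial_mul_choose, Nat.cast_mul]

theorem factorial_mul_card_coverSets (V W : Type*) [Fintype V] [Fintype W] (m : ℕ) :
    (m.factorial : ℂ) * (#(coverSets V W m) : ℂ) =
      ∑ j ∈ range (m + 1),
        fallCoeff m j * (altSum (Fintype.card V) (m - j) * altSum (Fintype.card W) (m - j)) := by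
  simp_rw [← sum_card_compl_pow_eq_altSum, sum_mul_sum, mul_sum]
  rw [card_coverSets, mul_sum, sum_comm]
  refine sum_congr rfl fun A _ => ?_
  rw [mul_sum, sum_comm]
  refine sum_congr rfl fun B _ => ?_
  rw [mul_left_comm, factorial_mul_choose_eq_sum, mul_sum]
  refine sum_congr rfl fun j _ => ?_
  push_cast
  ring

theorem factorial_mul_ncard_dicores (n m : ℕ) :
    (m.factorial : ℂ) * ((dicores n m).ncard : ℂ) =
      ∑ j ∈ range (m + 1), fallCoeff m j * altSum n (m - j) ^ 2 := by
  simp_rw [ncard_dicores, factorial_mul_card_coverSets, Fintype.card_fin, sq]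

end Counting

/-! ### The parameter `lam` -/

section Parameter

open Real

theorem exp_sub_one_pos {x : ℝ} (hx : 0 < x) : 0 < exp x - 1 :=
  sub_pos.2 (one_lt_exp_iff.2 hx)

theorem isParam_iff {c lam : ℝ} :
    IsParam c lam ↔ 0 < lam ∧ c * (exp lam - 1) = lam * exp lam :=
  and_congr_right fun h => eq_div_iff (exp_sub_one_pos h).ne'

-- `c⁻¹ = (1 - exp (-lam)) / lam` is a secant slope of the strictly convex function `exp`.
theorem strictAntiOn_one_sub_exp_neg_div :
    StrictAntiOn (fun x : ℝ => (1 - exp (-x)) / x) (Set.Ioi 0) := by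
  intro a ha b hb hab
  rw [Set.mem_Ioi] at ha hb
  have h := strictConvexOn_exp.secant_strict_mono (a := 0) (x := -b) (y := -a) (Set.mem_univ _)
    (Set.mem_univ _) (Set.mem_univ _) (by linarith) (by linarith) (by linarith)
  have slope_eq : ∀ x : ℝ, (exp (-x) - 1) / (-x) = (1 - exp (-x)) / x := fun x => by
    rw [div_neg, ← neg_div, neg_sub]
  simpa only [exp_zero, sub_zero, slope_eq] using h

theorem IsParam.eq {c x y : ℝ} (hx : IsParam c x) (hy : IsParam c y) : x = y := by
  have inv_eq : ∀ z, IsParam c z → (1 - exp (-z)) / z = c⁻¹ := by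
    rintro z ⟨hz, rfl⟩
    have := exp_sub_one_pos hz
    rw [exp_neg]
    field_simp
  exact strictAntiOn_one_sub_exp_neg_div.injOn hx.1 hy.1 ((inv_eq x hx).trans (inv_eq y hy).symm)

theorem existsUnique_isParam {c : ℝ} (hc : 1 < c) : ∃! lam : ℝ, IsParam c lam := by
  have hcont : ContinuousOn (fun x : ℝ => x * exp x / (exp x - 1)) (Set.Icc (c - 1) c) :=
    ContinuousOn.div (by fun_prop) (by fun_prop) fun x hx =>
      (exp_sub_one_pos (by linarith [hx.1])).ne'
  have h_left : (c - 1) * exp (c - 1) / (exp (c - 1) - 1) ≤ c := by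
    have := add_one_lt_exp (x := c - 1) (by linarith)
    rw [div_le_iff₀ (by linarith)]
    nlinarith
  have h_right : c ≤ c * exp c / (exp c - 1) := by
    rw [le_div_iff₀ (exp_sub_one_pos (by linarith))]
    nlinarith
  obtain ⟨x, hx, hxc⟩ := intermediate_value_Icc (by linarith) hcont ⟨h_left, h_right⟩
  have hparam : IsParam c x := ⟨by linarith [hx.1], hxc.symm⟩
  exact ⟨x, hparam, fun y hy => hy.eq hparam⟩

section IsParam

variable {c lam : ℝ}

theorem IsParam.lt (h : IsParam c lam) : lam < c := by
  obtain ⟨hlam, heq⟩ := isParam_iff.1 h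
  nlinarith [exp_sub_one_pos hlam]

theorem IsParam.le_one_add (h : IsParam c lam) : c ≤ 1 + lam := by
  obtain ⟨hlam, heq⟩ := isParam_iff.1 h
  nlinarith [add_one_lt_exp hlam.ne']

theorem IsParam.one_lt (h : IsParam c lam) : 1 < c := by
  obtain ⟨hlam, heq⟩ := isParam_iff.1 h
  have h_neg := add_one_lt_exp (neg_ne_zero.2 hlam.ne')
  have h_inv : exp lam * exp (-lam) = 1 := by rw [← exp_add, add_neg_cancel, exp_zero]
  nlinarith [exp_sub_one_pos hlam, exp_pos lam]

-- The zero-truncated Poisson distribution with parameter `lam` has mean `c` and variance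
-- `c * (1 + lam - c)`.
theorem IsParam.variance_le (h : IsParam c lam) : c * (1 + lam - c) ≤ lam := by
  nlinarith [h.one_lt, h.lt]

theorem IsParam.half_le_variance (h : IsParam c lam) : lam / 2 ≤ c * (1 + lam - c) := by
  have hlt := h.lt
  obtain ⟨hlam, heq⟩ := isParam_iff.1 h
  have hexp := quadratic_le_exp_of_nonneg hlam.le
  obtain ⟨u, rfl⟩ : ∃ u, c = u + lam := ⟨c - lam, by ring⟩
  have hu : 0 < u := by linarith
  have hmul : u * (1 + lam / 2) ≤ 1 := by
    have : u * (lam + lam ^ 2 / 2) ≤ lam := by nlinarith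
    nlinarith
  nlinarith [mul_nonneg hu.le (sub_nonneg.2 hmul), mul_pos hu hlam]

end IsParam

end Parameter

/-! ### Fourier integrals -/

section Fourier

open MeasureTheory Complex Finset
open scoped Real

theorem integral_exp_int_mul_I (k : ℤ) :
    ∫ φ in (-π)..π, exp (k * φ * I) = if k = 0 then (2 * π : ℂ) else 0 := by
  split_ifs with hk
  · subst hk
    simp only [Int.cast_zero, zero_mul, exp_zero, intervalIntegral.integral_const, sub_neg_eq_add,
      real_smul, ofReal_add, mul_one]
    ring
  · have hkI : (k : ℂ) * I ≠ 0 := by simp [hk]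
    simp_rw [mul_right_comm (k : ℂ) _ I]
    rw [integral_exp_mul_complex hkI, div_eq_zero_iff]
    left
    rw [sub_eq_zero, exp_eq_exp_iff_exists_int]
    exact ⟨k, by push_cast; ring⟩

theorem hasSum_exp_mul_exp (a : ℂ) (k : ℕ) (φ : ℝ) :
    HasSum (fun j : ℕ => (a ^ j / j.factorial) * exp (((j - k : ℤ) : ℂ) * φ * I))
      (exp (a * exp (φ * I)) * exp (-(k * φ * I))) := by
  have h := (NormedSpace.expSeries_div_hasSum_exp (a * exp (φ * I))).mul_right (exp (-(k * φ * I)))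
  rw [← exp_eq_exp_ℂ] at h
  refine h.congr_fun fun j => ?_
  rw [mul_pow, ← exp_nat_mul, mul_div_right_comm, mul_assoc (a ^ j / _), ← exp_add]
  congr 2
  push_cast
  ring

theorem integral_exp_mul_exp (a : ℂ) (k : ℕ) :
    ∫ φ in (-π)..π, exp (a * exp (φ * I)) * exp (-(k * φ * I)) =
      2 * π * (a ^ k / k.factorial) := by
  have h := intervalIntegral.hasSum_integral_of_dominated_convergence
    (μ := volume) (a := -π) (b := π)
    (F := fun (j : ℕ) (φ : ℝ) => (a ^ j / j.factorial) * exp (((j - k : ℤ) : ℂ) * φ * I))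
    (fun j _ => ‖a‖ ^ j / j.factorial)
    (fun j => (by fun_prop : Continuous _).aestronglyMeasurable)
    (fun j => ae_of_all _ fun φ _ => by
      have : ((j - k : ℤ) : ℂ) * φ * I = (((j - k : ℤ) : ℝ) * φ : ℝ) * I := by push_cast; ring
      rw [norm_mul, this, norm_exp_ofReal_mul_I]
      simp)
    (ae_of_all _ fun φ _ => Real.summable_pow_div_factorial ‖a‖)
    (by simp)
    (ae_of_all _ fun φ _ => hasSum_exp_mul_exp a k φ)
  simp_rw [intervalIntegral.integral_const_mul, integral_exp_int_mul_I] at h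
  refine h.unique ?_
  refine (hasSum_ite_eq k (2 * π * (a ^ k / k.factorial))).congr_fun fun j => ?_
  simp only [sub_eq_zero, Nat.cast_inj]
  split_ifs with hj
  · rw [hj, mul_comm]
  · rw [mul_zero]

theorem altSum_eq_integral (lam : ℝ) (n k : ℕ) :
    altSum n k * (lam : ℂ) ^ k * (2 * π) = k.factorial *
      ∫ φ in (-π)..π, (exp (lam * exp (φ * I)) - 1) ^ n * exp (-(k * φ * I)) := by
  have binomial : ∀ φ : ℝ, (exp (lam * exp (φ * I)) - 1) ^ n * exp (-(k * φ * I)) =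
      ∑ i ∈ range (n + 1), (-1) ^ (n - i) * (n.choose i : ℂ) *
        (exp ((i * lam : ℂ) * exp (φ * I)) * exp (-(k * φ * I))) := by
    intro φ
    rw [sub_eq_add_neg, add_pow, sum_mul]
    refine sum_congr rfl fun i _ => ?_
    rw [← exp_nat_mul, mul_assoc (i : ℂ)]
    ring
  simp_rw [binomial]
  rw [intervalIntegral.integral_finsetSum fun i _ =>
    (by fun_prop : Continuous _).intervalIntegrable _ _]
  simp_rw [intervalIntegral.integral_const_mul, integral_exp_mul_exp]
  rw [altSum, sum_mul, sum_mul, mul_sum]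
  refine sum_congr rfl fun i _ => ?_
  have : (k.factorial : ℂ) ≠ 0 := Nat.cast_ne_zero.2 k.factorial_ne_zero
  rw [mul_pow]
  field_simp

/-- The characteristic function of the zero-truncated Poisson distribution. -/
noncomputable def chi (lam φ : ℝ) : ℂ := (exp (lam * exp (φ * I)) - 1) / (exp lam - 1)

@[fun_prop]
theorem continuous_chi (lam : ℝ) : Continuous (chi lam) := by
  unfold chi
  fun_prop

theorem norm_sinh_le (z : ℂ) : ‖sinh z‖ ≤ Real.sinh ‖z‖ :=
  (hasSum_sinh z).norm_le_of_bounded (Real.hasSum_sinh ‖z‖) fun n => by simp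

-- Write `exp w - 1 = 2 * exp (w / 2) * sinh (w / 2)`, where `sinh` has nonnegative coefficients.
theorem norm_exp_sub_one_le (w : ℂ) :
    ‖exp w - 1‖ ≤ Real.exp (-((‖w‖ - w.re) / 2)) * (Real.exp ‖w‖ - 1) := by
  have h_exp : exp w - 1 = 2 * exp (w / 2) * sinh (w / 2) := by
    have h_sq : exp w = exp (w / 2) * exp (w / 2) := by rw [← exp_add, add_halves]
    have h_inv : exp (w / 2) * exp (-(w / 2)) = 1 := by rw [← exp_add, add_neg_cancel, exp_zero]
    rw [sinh, h_sq]
    linear_combination h_inv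
  have h_norm : ‖w / 2‖ = ‖w‖ / 2 := by simp
  have h_re : (w / 2).re = w.re / 2 := by simp
  have h_real : 2 * Real.exp (w.re / 2) * Real.sinh (‖w‖ / 2) =
      Real.exp (-((‖w‖ - w.re) / 2)) * (Real.exp ‖w‖ - 1) := by
    have h_add : Real.exp (-((‖w‖ - w.re) / 2)) * Real.exp ‖w‖ =
        Real.exp (w.re / 2) * Real.exp (‖w‖ / 2) := by
      rw [← Real.exp_add, ← Real.exp_add]
      ring_nf
    have h_sub : Real.exp (-((‖w‖ - w.re) / 2)) = Real.exp (w.re / 2) * Real.exp (-(‖w‖ / 2)) := by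
      rw [← Real.exp_add]
      ring_nf
    rw [Real.sinh_eq, mul_sub, h_add, h_sub]
    ring
  rw [h_exp, norm_mul, norm_mul, norm_exp, h_re, Complex.norm_two, ← h_real, ← h_norm]
  gcongr
  exact norm_sinh_le _

theorem ofReal_exp_sub_one_ne_zero {lam : ℝ} (hlam : 0 < lam) : exp (lam : ℂ) - 1 ≠ 0 :=
  mod_cast (exp_sub_one_pos hlam).ne'

theorem norm_chi_le {lam φ : ℝ} (hlam : 0 < lam) (hφ : |φ| ≤ π) :
    ‖chi lam φ‖ ≤ Real.exp (-(lam * φ ^ 2 / π ^ 2)) := by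
  have hpos := exp_sub_one_pos hlam
  have h_norm : ‖(lam : ℂ) * exp (φ * I)‖ = lam := by
    rw [norm_mul, norm_exp_ofReal_mul_I, mul_one, norm_real, Real.norm_of_nonneg hlam.le]
  have h_re : ((lam : ℂ) * exp (φ * I)).re = lam * Real.cos φ := by
    rw [re_ofReal_mul, exp_ofReal_mul_I_re]
  have h_den : ‖exp (lam : ℂ) - 1‖ = Real.exp lam - 1 := by
    rw [← ofReal_exp, ← ofReal_one, ← ofReal_sub, norm_real, Real.norm_of_nonneg hpos.le]
  rw [chi, norm_div, h_den, div_le_iff₀ hpos]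
  refine (norm_exp_sub_one_le _).trans ?_
  rw [h_norm, h_re]
  refine mul_le_mul_of_nonneg_right (Real.exp_le_exp.2 (neg_le_neg ?_)) hpos.le
  calc lam * φ ^ 2 / π ^ 2 = (lam - lam * (1 - 2 / π ^ 2 * φ ^ 2)) / 2 := by ring
    _ ≤ (lam - lam * Real.cos φ) / 2 := by
        gcongr
        exact Real.cos_le_one_sub_mul_cos_sq hφ

/-- Lebesgue measure on `(-π, π]`. -/
noncomputable def circleMeasure : Measure ℝ := volume.restrict (Set.Ioc (-π) π)

instance : IsFiniteMeasure circleMeasure :=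
  inferInstanceAs (IsFiniteMeasure (volume.restrict _))

theorem integrable_circleMeasure {E : Type*} [NormedAddCommGroup E] {f : ℝ → E}
    (hf : Continuous f) : Integrable f circleMeasure :=
  hf.integrableOn_Icc.mono_set Set.Ioc_subset_Icc_self

theorem integral_circleMeasure {E : Type*} [NormedAddCommGroup E] [NormedSpace ℝ E] (f : ℝ → E) :
    ∫ φ, f φ ∂circleMeasure = ∫ φ in (-π)..π, f φ :=
  (intervalIntegral.integral_of_le (by linarith [Real.pi_pos])).symm

theorem integral_chi_pow_mul_exp {lam : ℝ} (hlam : 0 < lam) (n k : ℕ) :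
    (∫ φ, chi lam φ ^ n * exp (-(k * φ * I)) ∂circleMeasure) * (exp lam - 1) ^ n * k.factorial =
      altSum n k * (lam : ℂ) ^ k * (2 * π) := by
  have := ofReal_exp_sub_one_ne_zero hlam
  rw [altSum_eq_integral, integral_circleMeasure, mul_comm,
    ← intervalIntegral.integral_mul_const]
  congr 2 with φ
  rw [chi, div_pow]
  field_simp

/-- The polynomial whose value near `lam ^ 2` approximates the probability that no arc is repeated
when the arcs are drawn by pairing the points of two random degree sequences. -/
noncomputable def simpleFactor (m : ℕ) (z : ℂ) : ℂ :=
  ∑ j ∈ range (m + 1), fallCoeff m j * ((m - j).factorial / m.factorial) ^ 2 * z ^ j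

@[fun_prop]
theorem continuous_simpleFactor (m : ℕ) : Continuous (simpleFactor m) := by
  unfold simpleFactor
  fun_prop

theorem chi_pow_mul_simpleFactor_eq_sum (lam φ ψ : ℝ) (n m : ℕ) :
    chi lam φ ^ n * chi lam ψ ^ n * exp (-(m * (φ + ψ) * I)) *
      simpleFactor m (lam ^ 2 * exp ((φ + ψ) * I)) =
    ∑ j ∈ range (m + 1), fallCoeff m j * ((m - j).factorial / m.factorial) ^ 2 * (lam ^ 2) ^ j *
      ((chi lam φ ^ n * exp (-((m - j : ℕ) * φ * I))) *
        (chi lam ψ ^ n * exp (-((m - j : ℕ) * ψ * I)))) := by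
  rw [simpleFactor, mul_sum]
  refine sum_congr rfl fun j hj => ?_
  have hjm : j ≤ m := mem_range_succ_iff.1 hj
  have h_exp : exp (-(m * (φ + ψ) * I)) * exp ((φ + ψ) * I) ^ j =
      exp (-((m - j : ℕ) * φ * I)) * exp (-((m - j : ℕ) * ψ * I)) := by
    rw [← exp_nat_mul, ← exp_add, ← exp_add]
    congr 1
    push_cast [Nat.cast_sub hjm]
    ring
  rw [mul_pow]
  linear_combination (chi lam φ ^ n * chi lam ψ ^ n * fallCoeff m j *
    ((m - j).factorial / m.factorial) ^ 2 * (lam ^ 2) ^ j) * h_exp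

theorem ncard_dicores_eq_integral {lam : ℝ} (hlam : 0 < lam) (n m : ℕ) :
    ((dicores n m).ncard : ℂ) * (lam ^ (2 * m) / (m.factorial * (exp lam - 1) ^ (2 * n))) *
      (2 * π) ^ 2 =
    ∫ p, chi lam p.1 ^ n * chi lam p.2 ^ n * exp (-(m * (p.1 + p.2) * I)) *
      simpleFactor m (lam ^ 2 * exp ((p.1 + p.2) * I)) ∂(circleMeasure.prod circleMeasure) := by
  have hE := ofReal_exp_sub_one_ne_zero hlam
  have hm : (m.factorial : ℂ) ≠ 0 := Nat.cast_ne_zero.2 m.factorial_ne_zero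
  let f : ℕ → ℝ → ℂ := fun k φ => chi lam φ ^ n * exp (-(k * φ * I))
  have hf : ∀ k, Integrable (f k) circleMeasure := fun k => integrable_circleMeasure (by fun_prop)
  have h_prod : ∀ k, ∫ p : ℝ × ℝ, f k p.1 * f k p.2 ∂(circleMeasure.prod circleMeasure) =
      (∫ φ, f k φ ∂circleMeasure) ^ 2 := fun k => by rw [integral_prod_mul, sq]
  simp_rw [chi_pow_mul_simpleFactor_eq_sum]
  rw [integral_finsetSum _ fun j _ => ((hf _).mul_prod (hf _)).const_mul _]
  simp_rw [integral_const_mul]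
  rw [eq_div_of_mul_eq hm ((mul_comm _ _).trans (factorial_mul_ncard_dicores n m)), sum_div,
    sum_mul, sum_mul]
  refine sum_congr rfl fun j hj => ?_
  rw [h_prod]
  have h_sq : ((∫ φ, f (m - j) φ ∂circleMeasure) * (exp lam - 1) ^ n * (m - j).factorial) ^ 2 =
      (altSum n (m - j) * (lam : ℂ) ^ (m - j) * (2 * π)) ^ 2 := by
    rw [← integral_chi_pow_mul_exp hlam]
  have h_pow : (lam : ℂ) ^ (2 * m) = (lam ^ (m - j)) ^ 2 * (lam ^ 2) ^ j := by
    rw [← pow_mul, ← pow_mul, ← pow_add]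
    congr 1
    have := mem_range_succ_iff.1 hj
    omega
  rw [h_pow]
  field_simp
  linear_combination (-fallCoeff m j) * (lam ^ 2) ^ j * h_sq

end Fourier

/-! ### Negative moments of the Gamma distribution -/

section GammaMoments

open MeasureTheory ProbabilityTheory Finset

theorem integral_pow_mul_exp (k : ℕ) {r : ℝ} (hr : 0 < r) :
    ∫ s in Set.Ioi (0 : ℝ), s ^ k * Real.exp (-(r * s)) = k.factorial / r ^ (k + 1) := by
  have h := Real.integral_rpow_mul_exp_neg_mul_Ioi (a := k + 1) (by positivity) hr
  simp only [Real.Gamma_nat_eq_factorial, add_sub_cancel_right, Real.rpow_natCast] at h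
  rw [h, ← Nat.cast_succ, Real.rpow_natCast, one_div, inv_pow]
  field_simp

theorem gammaMeasure_natCast_add_one (m : ℕ) :
    gammaMeasure (m + 1) 1 = (volume.restrict (Set.Ioi 0)).withDensity fun s =>
      ENNReal.ofReal (s ^ m * Real.exp (-s) / m.factorial) := by
  rw [gammaMeasure, restrict_Ioi_eq_restrict_Ici, ← withDensity_indicator measurableSet_Ici]
  congr 1 with s
  by_cases hs : 0 ≤ s
  · rw [Set.indicator_of_mem (Set.mem_Ici.2 hs), gammaPDF_of_nonneg hs,
      Real.Gamma_nat_eq_factorial, Real.one_rpow, add_sub_cancel_right, Real.rpow_natCast, one_mul]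
    congr 1
    ring
  · rw [Set.indicator_of_notMem (by simpa using hs), gammaPDF_of_neg (not_le.1 hs)]

theorem integral_gammaMeasure (m : ℕ) (f : ℝ → ℝ) :
    ∫ s, f s ∂gammaMeasure (m + 1) 1 =
      ∫ s in Set.Ioi 0, s ^ m * Real.exp (-s) / m.factorial * f s := by
  rw [gammaMeasure_natCast_add_one, integral_withDensity_eq_integral_toReal_smul (by fun_prop)
    (ae_of_all _ fun _ => ENNReal.ofReal_lt_top)]
  refine setIntegral_congr_fun measurableSet_Ioi fun s (hs : 0 < s) => ?_
  rw [ENNReal.toReal_ofReal (by positivity), smul_eq_mul]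

theorem ae_pos_gammaMeasure (m : ℕ) : ∀ᵐ s ∂gammaMeasure (m + 1) 1, 0 < s := by
  rw [gammaMeasure_natCast_add_one]
  exact withDensity_absolutelyContinuous _ _ (ae_restrict_mem measurableSet_Ioi)

instance (m : ℕ) : IsProbabilityMeasure (gammaMeasure (m + 1) 1) :=
  isProbabilityMeasure_gammaMeasure (by positivity) one_pos

/-- The normalized negative moments `E[(m / s) ^ j]` of a random variable `s` with the Gamma
distribution of shape `m + 1`. -/
noncomputable def gammaWeight (m j : ℕ) : ℝ := m ^ j * (m - j).factorial / m.factorial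

theorem gammaWeight_nonneg (m j : ℕ) : 0 ≤ gammaWeight m j := by
  unfold gammaWeight
  positivity

theorem gammaWeight_pos {m j : ℕ} (hj : j ≤ m) : 0 < gammaWeight m j := by
  rcases j.eq_zero_or_pos with rfl | hj0
  · rw [gammaWeight, pow_zero]
    positivity
  · have : 0 < m := hj0.trans_le hj
    unfold gammaWeight
    positivity

theorem pow_mul_factorial_le_pow_mul_descFactorial {m j : ℕ} (hj : j ≤ m) :
    m ^ j * j.factorial ≤ j ^ j * m.descFactorial j := by
  rw [← Nat.descFactorial_self, Nat.descFactorial_eq_prod_range, Nat.descFactorial_eq_prod_range,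
    ← card_range j, ← prod_const, ← prod_const, card_range, ← prod_mul_distrib, ← prod_mul_distrib]
  refine prod_le_prod' fun i hi => ?_
  have hij : i < j := mem_range.1 hi
  zify [hij.le, hij.le.trans hj]
  nlinarith

theorem natCast_pow_self_le (j : ℕ) : (j : ℝ) ^ j ≤ 3 ^ j * j.factorial := by
  have h := Real.pow_div_factorial_le_exp (j : ℝ) (by positivity) j
  rw [div_le_iff₀ (by positivity), ← mul_one (j : ℝ), Real.exp_nat_mul, mul_one] at h
  refine h.trans ?_
  gcongr
  linarith [Real.exp_one_lt_d9]

theorem gammaWeight_le {m j : ℕ} (hj : j ≤ m) : gammaWeight m j ≤ 3 ^ j := by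
  have h_desc : (m : ℝ) ^ j ≤ 3 ^ j * m.descFactorial j := by
    have h : (m : ℝ) ^ j * j.factorial ≤ j ^ j * m.descFactorial j :=
      mod_cast pow_mul_factorial_le_pow_mul_descFactorial hj
    refine le_of_mul_le_mul_right (a := (j.factorial : ℝ)) ?_ (by positivity)
    calc (m : ℝ) ^ j * j.factorial ≤ j ^ j * m.descFactorial j := h
      _ ≤ (3 ^ j * j.factorial) * m.descFactorial j := by
          gcongr
          exact natCast_pow_self_le j
      _ = 3 ^ j * m.descFactorial j * j.factorial := by ring
  rw [gammaWeight, div_le_iff₀ (by positivity), ← Nat.factorial_mul_descFactorial hj]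
  push_cast
  calc (m : ℝ) ^ j * (m - j).factorial ≤ 3 ^ j * m.descFactorial j * (m - j).factorial := by gcongr
    _ = 3 ^ j * ((m - j).factorial * m.descFactorial j) := by ring

theorem integral_div_pow_mul_exp {m j : ℕ} (hj : j ≤ m) {v : ℝ} (hv : -1 < v) :
    ∫ s, (m / s) ^ j * Real.exp (-(v * s)) ∂gammaMeasure (m + 1) 1 =
      gammaWeight m j / (1 + v) ^ (m - j + 1) := by
  rw [integral_gammaMeasure]
  calc _ = ∫ s in Set.Ioi 0,
        m ^ j / m.factorial * (s ^ (m - j) * Real.exp (-((1 + v) * s))) := by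
        refine setIntegral_congr_fun measurableSet_Ioi fun s (hs : 0 < s) => ?_
        have h_exp : Real.exp (-((1 + v) * s)) = Real.exp (-s) * Real.exp (-(v * s)) := by
          rw [← Real.exp_add]
          ring_nf
        have h_pow : s ^ m = s ^ (m - j) * s ^ j := by rw [← pow_add, Nat.sub_add_cancel hj]
        simp only [h_exp, h_pow, div_pow]
        field_simp
    _ = _ := by
        rw [integral_const_mul, integral_pow_mul_exp _ (by linarith), gammaWeight]
        ring

theorem integrable_div_pow_mul_exp {m j : ℕ} (hj : j ≤ m) {v : ℝ} (hv : -1 < v) :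
    Integrable (fun s => (m / s) ^ j * Real.exp (-(v * s))) (gammaMeasure (m + 1) 1) := by
  refine Integrable.of_integral_ne_zero ?_
  rw [integral_div_pow_mul_exp hj hv]
  have := gammaWeight_pos hj
  have : 0 < 1 + v := by linarith
  positivity

theorem integral_div_pow {m j : ℕ} (hj : j ≤ m) :
    ∫ s, (m / s) ^ j ∂gammaMeasure (m + 1) 1 = gammaWeight m j := by
  simpa using integral_div_pow_mul_exp hj (v := 0) (by norm_num)

theorem integrable_div_pow {m j : ℕ} (hj : j ≤ m) :
    Integrable (fun s : ℝ => (m / s) ^ j) (gammaMeasure (m + 1) 1) := by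
  simpa using integrable_div_pow_mul_exp hj (v := 0) (by norm_num)

theorem exp_sub_sq_le_one_add {u : ℝ} (hu : |u| ≤ 1 / 2) : Real.exp (u - u ^ 2) ≤ 1 + u := by
  rw [abs_le] at hu
  suffices h : 1 ≤ (1 + u) * Real.exp (-(u - u ^ 2)) by
    rwa [Real.exp_neg, ← div_eq_mul_inv, le_div_iff₀ (Real.exp_pos _), one_mul] at h
  rcases le_total 0 u with h | h
  · nlinarith [Real.add_one_le_exp (-(u - u ^ 2)), mul_nonneg h h, mul_nonneg (mul_nonneg h h) h]
  · obtain ⟨v, rfl⟩ : ∃ v, u = -v := ⟨-u, (neg_neg u).symm⟩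
    have hv : 0 ≤ v := by linarith
    have hv_half : 0 ≤ 1 / 2 - v := by linarith
    have h_quad := Real.quadratic_le_exp_of_nonneg (x := -(-v - (-v) ^ 2)) (by nlinarith)
    have h_cubic : 0 ≤ (1 - v) * (1 + v) ^ 2 / 2 - v := by
      nlinarith [mul_nonneg hv hv, mul_nonneg hv hv_half, mul_nonneg (mul_nonneg hv hv) hv_half]
    calc 1 ≤ 1 + v ^ 2 * ((1 - v) * (1 + v) ^ 2 / 2 - v) :=
          le_add_of_nonneg_right (by positivity)
      _ = (1 + -v) * (1 + -(-v - (-v) ^ 2) + (-(-v - (-v) ^ 2)) ^ 2 / 2) := by ring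
      _ ≤ (1 + -v) * Real.exp (-(-v - (-v) ^ 2)) := by
          gcongr
          linarith

/-- The exponential with rate `v` that Chernoff's bound uses to control a Gamma variable below
`(1 - 2 * v) * m` if `0 < v`, and above it if `v < 0`. -/
noncomputable def tilt (m : ℕ) (v s : ℝ) : ℝ := Real.exp (v * ((1 - 2 * v) * m - s))

theorem tilt_pos (m : ℕ) (v s : ℝ) : 0 < tilt m v s := Real.exp_pos _

theorem mul_tilt_eq (m : ℕ) (a v s : ℝ) :
    a * tilt m v s = Real.exp (v * (1 - 2 * v) * m) * (a * Real.exp (-(v * s))) := by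
  rw [tilt, mul_left_comm, ← Real.exp_add]
  ring_nf

theorem one_le_tilt_add_tilt (m : ℕ) {v s : ℝ} (hv : 0 ≤ v) (hs : 2 * v * m < |s - m|) :
    1 ≤ tilt m v s + tilt m (-v) s := by
  rcases lt_abs.1 hs with h | h
  · have : 1 ≤ tilt m (-v) s := Real.one_le_exp (by nlinarith)
    linarith [tilt_pos m v s]
  · have : 1 ≤ tilt m v s := Real.one_le_exp (by nlinarith)
    linarith [tilt_pos m (-v) s]

theorem integrable_div_pow_mul_tilt {m j : ℕ} (hj : j ≤ m) {v : ℝ} (hv : -1 < v) :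
    Integrable (fun s => (m / s) ^ j * tilt m v s) (gammaMeasure (m + 1) 1) := by
  simp_rw [mul_tilt_eq]
  exact (integrable_div_pow_mul_exp hj hv).const_mul _

theorem integral_div_pow_mul_tilt_le {m j : ℕ} (hj : j ≤ m) {v : ℝ} (hv : |v| ≤ 1 / 2) :
    ∫ s, (m / s) ^ j * tilt m v s ∂gammaMeasure (m + 1) 1 ≤
      2 * 6 ^ j * Real.exp (-(m * v ^ 2)) := by
  obtain ⟨hv_lower, hv_upper⟩ := abs_le.1 hv
  have hpos : 0 < 1 + v := by linarith
  simp_rw [mul_tilt_eq]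
  rw [integral_const_mul, integral_div_pow_mul_exp hj (by linarith), ← mul_div_assoc,
    div_le_iff₀ (by positivity)]
  have h_exp : Real.exp (v * (1 - 2 * v) * m) ≤ Real.exp (-(m * v ^ 2)) * (1 + v) ^ m := by
    calc Real.exp (v * (1 - 2 * v) * m) = Real.exp (-(m * v ^ 2)) * Real.exp (v - v ^ 2) ^ m := by
          rw [← Real.exp_nat_mul, ← Real.exp_add]
          ring_nf
      _ ≤ _ := by
          gcongr
          exact exp_sub_sq_le_one_add hv
  have h_pow : (1 + v) ^ m ≤ 2 ^ j * (2 * (1 + v) ^ (m - j + 1)) := by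
    calc (1 + v) ^ m = (1 + v) ^ j * (1 + v) ^ (m - j) := by rw [← pow_add, Nat.add_sub_cancel' hj]
      _ ≤ 2 ^ j * (2 * (1 + v) * (1 + v) ^ (m - j)) := by
          gcongr
          · linarith
          · exact le_mul_of_one_le_left (by positivity) (by linarith)
      _ = _ := by ring
  calc _ ≤ Real.exp (-(m * v ^ 2)) * (2 ^ j * (2 * (1 + v) ^ (m - j + 1))) * 3 ^ j := by
        gcongr
        · exact gammaWeight_nonneg m j
        · exact h_exp.trans (by gcongr)
        · exact gammaWeight_le hj
    _ = 2 * (2 * 3 : ℝ) ^ j * Real.exp (-(m * v ^ 2)) * (1 + v) ^ (m - j + 1) := by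
        rw [mul_pow]
        ring
    _ = _ := by norm_num

end GammaMoments

/-! ### Gamma averages of polynomials -/

section GammaAverage

open MeasureTheory ProbabilityTheory Finset

theorem norm_le_two_mul_of_norm_sub_le {z : ℂ} {ρ α : ℝ} (hα : α ≤ 1) (hρ : 0 ≤ ρ)
    (hz : ‖z - ρ‖ ≤ α * ρ) : ‖z‖ ≤ 2 * ρ := by
  have h := norm_le_insert' z (ρ : ℂ)
  rw [Complex.norm_real, Real.norm_of_nonneg hρ] at h
  nlinarith

theorem norm_mul_div_sub_le {z : ℂ} {ρ α δ m s : ℝ} (hα : α ≤ 1) (hδ : 0 ≤ δ) (hδ_half : δ ≤ 1 / 2)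
    (hρ : 0 ≤ ρ) (hm : 0 < m) (hz : ‖z - ρ‖ ≤ α * ρ) (hs : |s - m| ≤ δ * m) :
    ‖z * (m / s : ℝ) - ρ‖ ≤ (α + 4 * δ) * ρ := by
  have hs_half : m / 2 ≤ s := by nlinarith [(abs_le.1 hs).1]
  have hs_pos : 0 < s := by linarith
  have hz_norm : ‖z‖ ≤ 2 * ρ := norm_le_two_mul_of_norm_sub_le hα hρ hz
  have h_ratio : |m / s - 1| ≤ 2 * δ := by
    rw [div_sub_one hs_pos.ne', abs_div, abs_of_pos hs_pos, abs_sub_comm, div_le_iff₀ hs_pos]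
    nlinarith
  calc ‖z * (m / s : ℝ) - ρ‖ = ‖(z - ρ) + z * (m / s - 1 : ℝ)‖ := by
        push_cast
        ring_nf
    _ ≤ ‖z - ρ‖ + ‖z‖ * |m / s - 1| := by
        refine (norm_add_le _ _).trans_eq ?_
        rw [norm_mul, Complex.norm_real, Real.norm_eq_abs]
    _ ≤ α * ρ + 2 * ρ * (2 * δ) := by gcongr
    _ = (α + 4 * δ) * ρ := by ring

theorem norm_sum_mul_pow_sub_le (b : ℕ → ℂ) (w z : ℂ) (m : ℕ) {x : ℝ} (hx : 0 ≤ x) :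
    ‖∑ j ∈ range (m + 1), b j * (z * x) ^ j - w‖ ≤
      ∑ j ∈ range (m + 1), ‖b j‖ * ‖z‖ ^ j * x ^ j + ‖w‖ := by
  refine (norm_sub_le _ _).trans (add_le_add_left (norm_sum_le_of_le _ fun j _ => ?_) _)
  rw [norm_mul, norm_pow, norm_mul, Complex.norm_real, Real.norm_of_nonneg hx, mul_pow, mul_assoc]

theorem integrable_sum_div_pow_mul_tilt (a : ℕ → ℝ) (c : ℝ) (m : ℕ) {v : ℝ} (hv : -1 < v) :
    Integrable (fun s : ℝ => (∑ j ∈ range (m + 1), a j * (m / s) ^ j + c) * tilt m v s)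
      (gammaMeasure (m + 1) 1) := by
  simp_rw [add_mul, sum_mul, mul_assoc]
  refine (integrable_finsetSum _ fun j hj => ?_).add ?_
  · exact (integrable_div_pow_mul_tilt (mem_range_succ_iff.1 hj) hv).const_mul _
  · simpa using (integrable_div_pow_mul_tilt m.zero_le hv).const_mul c

theorem integral_sum_div_pow_mul_tilt_le {a : ℕ → ℝ} {c : ℝ} (ha : ∀ j, 0 ≤ a j) (hc : 0 ≤ c)
    (m : ℕ) {v : ℝ} (hv : |v| ≤ 1 / 2) :
    ∫ s, (∑ j ∈ range (m + 1), a j * (m / s) ^ j + c) * tilt m v s ∂gammaMeasure (m + 1) 1 ≤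
      2 * (∑ j ∈ range (m + 1), a j * 6 ^ j + c) * Real.exp (-(m * v ^ 2)) := by
  have hv_lower : -1 < v := by linarith [(abs_le.1 hv).1]
  have h_zero_int := integrable_div_pow_mul_tilt m.zero_le hv_lower
  have h_zero := integral_div_pow_mul_tilt_le m.zero_le hv
  simp only [pow_zero, one_mul, mul_one] at h_zero_int h_zero
  have h_int (j) (hj : j ∈ range (m + 1)) :=
    (integrable_div_pow_mul_tilt (mem_range_succ_iff.1 hj) hv_lower).const_mul (a j)
  simp_rw [add_mul, sum_mul, mul_assoc]
  rw [integral_add (integrable_finsetSum _ h_int) (h_zero_int.const_mul c),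
    integral_finsetSum _ h_int, integral_const_mul]
  calc _ ≤ ∑ j ∈ range (m + 1), a j * (2 * 6 ^ j * Real.exp (-(m * v ^ 2)))
        + c * (2 * Real.exp (-(m * v ^ 2))) := by
        gcongr with j hj
        rw [integral_const_mul]
        gcongr
        · exact ha j
        · exact integral_div_pow_mul_tilt_le (mem_range_succ_iff.1 hj) hv
    _ = _ := by
        simp_rw [add_mul, mul_add, sum_mul, mul_sum]
        congr 1
        · exact sum_congr rfl fun j _ => by ring
        · ring

theorem integrable_sum_div_pow_mul_tilt_add (a : ℕ → ℝ) (c : ℝ) (m : ℕ) {v : ℝ}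
    (hv : |v| ≤ 1 / 2) :
    Integrable (fun s : ℝ => (∑ j ∈ range (m + 1), a j * (m / s) ^ j + c) * tilt m v s +
      (∑ j ∈ range (m + 1), a j * (m / s) ^ j + c) * tilt m (-v) s) (gammaMeasure (m + 1) 1) := by
  obtain ⟨hv_lower, hv_upper⟩ := abs_le.1 hv
  exact (integrable_sum_div_pow_mul_tilt a c m (by linarith)).add
    (integrable_sum_div_pow_mul_tilt a c m (by linarith))

theorem integral_sum_div_pow_mul_tilt_add_le {a : ℕ → ℝ} {c : ℝ} (ha : ∀ j, 0 ≤ a j) (hc : 0 ≤ c)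
    (m : ℕ) {v : ℝ} (hv : |v| ≤ 1 / 2) :
    ∫ s, ((∑ j ∈ range (m + 1), a j * (m / s) ^ j + c) * tilt m v s +
      (∑ j ∈ range (m + 1), a j * (m / s) ^ j + c) * tilt m (-v) s) ∂gammaMeasure (m + 1) 1 ≤
      4 * (∑ j ∈ range (m + 1), a j * 6 ^ j + c) * Real.exp (-(m * v ^ 2)) := by
  obtain ⟨hv_lower, hv_upper⟩ := abs_le.1 hv
  rw [integral_add (integrable_sum_div_pow_mul_tilt a c m (by linarith))
    (integrable_sum_div_pow_mul_tilt a c m (by linarith))]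
  have h_pos := integral_sum_div_pow_mul_tilt_le ha hc m hv
  have h_neg := integral_sum_div_pow_mul_tilt_le ha hc m (v := -v) (by rwa [abs_neg])
  rw [neg_sq] at h_neg
  linarith

theorem sum_mul_gammaWeight_mul_pow_sub_eq_integral (b : ℕ → ℂ) (w z : ℂ) (m : ℕ) :
    ∑ j ∈ range (m + 1), b j * gammaWeight m j * z ^ j - w =
      ∫ s : ℝ, (∑ j ∈ range (m + 1), b j * (z * (m / s : ℝ)) ^ j - w) ∂gammaMeasure (m + 1) 1 := by
  simp_rw [mul_pow, ← Complex.ofReal_pow, ← mul_assoc]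
  have h_int (j) (hj : j ∈ range (m + 1)) : Integrable
      (fun s : ℝ => b j * z ^ j * ((m / s) ^ j : ℝ)) (gammaMeasure (m + 1) 1) :=
    (integrable_div_pow (mem_range_succ_iff.1 hj)).ofReal.const_mul _
  rw [integral_sub (integrable_finsetSum _ h_int) (integrable_const w), integral_finsetSum _ h_int,
    integral_const, probReal_univ, one_smul]
  congr 1
  refine sum_congr rfl fun j hj => ?_
  rw [integral_const_mul, integral_complex_ofReal, integral_div_pow (mem_range_succ_iff.1 hj),
    mul_right_comm]

theorem norm_sub_le_add_tilt {b : ℕ → ℂ} {w z : ℂ} {m : ℕ} {ρ α δ ε s : ℝ} (hm : 0 < m)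
    (hα : α ≤ 1) (hδ : 0 ≤ δ) (hδ_half : δ ≤ 1 / 2) (hρ : 0 ≤ ρ)
    (hb : ∀ y : ℂ, ‖y - ρ‖ ≤ (α + 4 * δ) * ρ → ‖∑ j ∈ range (m + 1), b j * y ^ j - w‖ ≤ ε)
    (hz : ‖z - ρ‖ ≤ α * ρ) (hs : 0 < s) :
    ‖∑ j ∈ range (m + 1), b j * (z * (m / s : ℝ)) ^ j - w‖ ≤ ε +
      ((∑ j ∈ range (m + 1), ‖b j‖ * ‖z‖ ^ j * (m / s) ^ j + ‖w‖) * tilt m (δ / 2) s +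
        (∑ j ∈ range (m + 1), ‖b j‖ * ‖z‖ ^ j * (m / s) ^ j + ‖w‖) * tilt m (-(δ / 2)) s) := by
  rw [← mul_add]
  have h_tilt : 0 < tilt m (δ / 2) s + tilt m (-(δ / 2)) s := add_pos (tilt_pos ..) (tilt_pos ..)
  have h_sum : 0 ≤ ∑ j ∈ range (m + 1), ‖b j‖ * ‖z‖ ^ j * (m / s) ^ j + ‖w‖ := by positivity
  rcases le_or_gt |s - m| (δ * m) with h_near | h_far
  · refine (hb _ (norm_mul_div_sub_le hα hδ hδ_half hρ (by positivity) hz h_near)).trans ?_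
    exact le_add_of_nonneg_right (by positivity)
  · have hε : 0 ≤ ε := (norm_nonneg _).trans (hb z (hz.trans (by nlinarith [mul_nonneg hδ hρ])))
    refine (norm_sum_mul_pow_sub_le b w z m (by positivity)).trans (le_add_of_nonneg_of_le hε ?_)
    exact le_mul_of_one_le_right h_sum (one_le_tilt_add_tilt m (by positivity) (by linarith))

theorem sum_norm_mul_pow_mul_six_pow_add_norm_le {b : ℕ → ℂ} {w z : ℂ} {m : ℕ} {ρ α A κ : ℝ}
    (hα : α ≤ 1) (hρ : 0 ≤ ρ) (hκ : 0 ≤ κ)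
    (hbw : ∀ x, 0 ≤ x → ∑ j ∈ range (m + 1), ‖b j‖ * x ^ j + ‖w‖ ≤ A * Real.exp (κ * x))
    (hz : ‖z - ρ‖ ≤ α * ρ) :
    ∑ j ∈ range (m + 1), ‖b j‖ * ‖z‖ ^ j * 6 ^ j + ‖w‖ ≤ A * Real.exp (12 * κ * ρ) := by
  have hA : 0 ≤ A := by
    simpa using (add_nonneg (sum_nonneg fun _ _ => by positivity) (norm_nonneg w)).trans
      (hbw 0 le_rfl)
  have h_norm : ‖z‖ ≤ 2 * ρ := norm_le_two_mul_of_norm_sub_le hα hρ hz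
  simp only [mul_assoc, ← mul_pow]
  refine (hbw _ (by positivity)).trans ?_
  gcongr A * Real.exp ?_
  nlinarith

-- The Gamma average of a polynomial that is nearly constant on a disc is still nearly constant on a
-- smaller disc: `z * m / s` leaves the larger one only with exponentially small probability.
theorem norm_sum_mul_gammaWeight_sub_le {b : ℕ → ℂ} {w z : ℂ} {m : ℕ} {ρ α δ ε A κ : ℝ}
    (hm : 0 < m) (hα : α ≤ 1) (hδ : 0 ≤ δ) (hδ_half : δ ≤ 1 / 2) (hρ : 0 ≤ ρ) (hκ : 0 ≤ κ)
    (hbw : ∀ x, 0 ≤ x → ∑ j ∈ range (m + 1), ‖b j‖ * x ^ j + ‖w‖ ≤ A * Real.exp (κ * x))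
    (hb : ∀ y : ℂ, ‖y - ρ‖ ≤ (α + 4 * δ) * ρ → ‖∑ j ∈ range (m + 1), b j * y ^ j - w‖ ≤ ε)
    (hz : ‖z - ρ‖ ≤ α * ρ) :
    ‖∑ j ∈ range (m + 1), b j * gammaWeight m j * z ^ j - w‖ ≤
      ε + 4 * A * Real.exp (12 * κ * ρ) * Real.exp (-(m * δ ^ 2 / 4)) := by
  have h_abs : |δ / 2| ≤ 1 / 2 := by
    rw [abs_of_nonneg (by positivity)]
    linarith
  have h_tilt := integrable_sum_div_pow_mul_tilt_add (fun j => ‖b j‖ * ‖z‖ ^ j) ‖w‖ m h_abs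
  rw [sum_mul_gammaWeight_mul_pow_sub_eq_integral]
  refine (norm_integral_le_of_norm_le ((integrable_const ε).add h_tilt)
    ((ae_pos_gammaMeasure m).mono fun s hs =>
      norm_sub_le_add_tilt hm hα hδ hδ_half hρ hb hz hs)).trans ?_
  rw [integral_add' (integrable_const ε) h_tilt, integral_const, probReal_univ, one_smul]
  gcongr
  calc _ ≤ 4 * (∑ j ∈ range (m + 1), ‖b j‖ * ‖z‖ ^ j * 6 ^ j + ‖w‖) *
        Real.exp (-(m * (δ / 2) ^ 2)) :=
        integral_sum_div_pow_mul_tilt_add_le (fun _ => by positivity) (norm_nonneg w) m h_abs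
    _ ≤ 4 * (A * Real.exp (12 * κ * ρ)) * Real.exp (-(m * (δ / 2) ^ 2)) := by
        gcongr
        exact sum_norm_mul_pow_mul_six_pow_add_norm_le hα hρ hκ hbw hz
    _ = _ := by ring_nf

end GammaAverage

/-! ### The factor `exp (-lam ^ 2 / 2)` -/

section SimpleFactor

open Finset

theorem sum_range_natCast {K : Type*} [Field K] [CharZero K] (m : ℕ) :
    ∑ i ∈ range m, (i : K) = m * (m - 1) / 2 := by
  induction m with
  | zero => simp
  | succ k ih =>
    rw [sum_range_succ, ih]
    push_cast
    ring

theorem sum_norm_fallCoeff_le (m : ℕ) {x : ℝ} (hx : 0 ≤ x) :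
    ∑ j ∈ range (m + 1), ‖fallCoeff m j‖ * x ^ j ≤ Real.exp (m ^ 2 * x / 2) := by
  calc _ ≤ ∑ j ∈ range (m + 1), ∑ t ∈ powersetCard j (range m), ∏ i ∈ t, (i * x : ℝ) := by
        refine sum_le_sum fun j _ => ?_
        refine (mul_le_mul_of_nonneg_right (norm_sum_le _ _) (by positivity)).trans ?_
        rw [sum_mul]
        refine sum_le_sum fun t ht => le_of_eq ?_
        rw [prod_mul_distrib, prod_const, (mem_powersetCard.1 ht).2, norm_prod]
        simp only [norm_neg, Complex.norm_natCast]
    _ = ∏ i ∈ range m, (1 + i * x : ℝ) := by rw [prod_one_add, sum_powerset, card_range]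
    _ ≤ ∏ i ∈ range m, Real.exp (i * x) := by
        gcongr with i
        rw [add_comm]
        exact Real.add_one_le_exp _
    _ = Real.exp (m * (m - 1) / 2 * x) := by rw [← Real.exp_sum, ← sum_mul, sum_range_natCast]
    _ ≤ _ := by
        gcongr
        nlinarith [mul_nonneg m.cast_nonneg hx]

theorem sum_norm_fallCoeff_div_le {m : ℕ} (hm : 0 < m) {x : ℝ} (hx : 0 ≤ x) :
    ∑ j ∈ range (m + 1), ‖fallCoeff m j / (m : ℂ) ^ (2 * j)‖ * x ^ j ≤ Real.exp (1 / 2 * x) := by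
  calc _ = ∑ j ∈ range (m + 1), ‖fallCoeff m j‖ * (x / m ^ 2) ^ j := by
        refine sum_congr rfl fun j _ => ?_
        rw [norm_div, norm_pow, Complex.norm_natCast, div_pow, ← pow_mul]
        ring
    _ ≤ Real.exp (m ^ 2 * (x / m ^ 2) / 2) := sum_norm_fallCoeff_le m (by positivity)
    _ = Real.exp (1 / 2 * x) := by field_simp

theorem sum_fallCoeff_div_mul_pow (m : ℕ) (z : ℂ) :
    ∑ j ∈ range (m + 1), fallCoeff m j / (m : ℂ) ^ (2 * j) * z ^ j =
      ∏ i ∈ range m, (1 - i * (z / m ^ 2)) := by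
  rw [prod_sub_mul_eq_sum_fallCoeff]
  refine sum_congr rfl fun j _ => ?_
  rw [one_pow, mul_one, div_pow, ← pow_mul]
  ring

theorem simpleFactor_eq {m : ℕ} (hm : 0 < m) (z : ℂ) : simpleFactor m z =
    ∑ j ∈ range (m + 1), fallCoeff m j / (m : ℂ) ^ (2 * j) * gammaWeight m j * gammaWeight m j *
      z ^ j := by
  have hm_ne : (m : ℂ) ≠ 0 := mod_cast hm.ne'
  refine sum_congr rfl fun j _ => ?_
  rw [gammaWeight, mul_comm 2 j, pow_mul]
  push_cast
  field_simp

theorem sum_norm_mul_gammaWeight_le (a : ℕ → ℂ) (m : ℕ) {x : ℝ} (hx : 0 ≤ x) :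
    ∑ j ∈ range (m + 1), ‖a j * gammaWeight m j‖ * x ^ j ≤
      ∑ j ∈ range (m + 1), ‖a j‖ * (3 * x) ^ j := by
  refine sum_le_sum fun j hj => ?_
  rw [norm_mul, Complex.norm_real, Real.norm_of_nonneg (gammaWeight_nonneg m j), mul_pow, mul_assoc]
  gcongr
  exact gammaWeight_le (mem_range_succ_iff.1 hj)

theorem norm_simpleFactor_le {m : ℕ} (hm : 0 < m) (z : ℂ) :
    ‖simpleFactor m z‖ ≤ Real.exp (5 * ‖z‖) := by
  rw [simpleFactor_eq hm]
  calc _ ≤ ∑ j ∈ range (m + 1),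
        ‖fallCoeff m j / (m : ℂ) ^ (2 * j) * gammaWeight m j * gammaWeight m j‖ * ‖z‖ ^ j :=
        norm_sum_le_of_le _ fun j _ => by rw [norm_mul _ (z ^ j), norm_pow]
    _ ≤ ∑ j ∈ range (m + 1), ‖fallCoeff m j / (m : ℂ) ^ (2 * j)‖ * (3 * (3 * ‖z‖)) ^ j :=
        (sum_norm_mul_gammaWeight_le _ m (norm_nonneg z)).trans
          (sum_norm_mul_gammaWeight_le _ m (by positivity))
    _ ≤ Real.exp (1 / 2 * (3 * (3 * ‖z‖))) := sum_norm_fallCoeff_div_le hm (by positivity)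
    _ ≤ Real.exp (5 * ‖z‖) := by
        rw [Real.exp_le_exp]
        linarith [norm_nonneg z]

theorem norm_log_one_sub_add_le {u : ℂ} (hu : ‖u‖ ≤ 1 / 2) :
    ‖Complex.log (1 - u) + u‖ ≤ ‖u‖ ^ 2 := by
  have h := Complex.norm_log_one_add_sub_self_le (z := -u) (by rw [norm_neg]; linarith)
  rw [norm_neg, sub_neg_eq_add, ← sub_eq_add_neg] at h
  have h_inv : (1 - ‖u‖)⁻¹ ≤ 2 := by
    rw [inv_le_comm₀ (by linarith) two_pos]
    linarith
  calc _ ≤ ‖u‖ ^ 2 * 2 / 2 := h.trans (by gcongr)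
    _ = ‖u‖ ^ 2 := by ring

theorem norm_natCast_mul_div_sq_le (z : ℂ) {i m : ℕ} (hi : i < m) :
    ‖i * (z / m ^ 2)‖ ≤ ‖z‖ / m := by
  rw [norm_mul, norm_div, norm_pow, Complex.norm_natCast, Complex.norm_natCast]
  calc _ ≤ m * (‖z‖ / m ^ 2) := by gcongr
    _ = ‖z‖ / m := by field_simp

theorem norm_sum_log_one_sub_add_le {m : ℕ} (hm : 0 < m) {z : ℂ} (hz : ‖z‖ / m ≤ 1 / 2) (ρ : ℂ) :
    ‖∑ i ∈ range m, Complex.log (1 - i * (z / m ^ 2)) + ρ / 2‖ ≤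
      ‖z - ρ‖ / 2 + ‖z‖ / (2 * m) + ‖z‖ ^ 2 / m := by
  have hm_ne : (m : ℂ) ≠ 0 := mod_cast hm.ne'
  have h_sum : ∑ i ∈ range m, i * (z / m ^ 2) = z / 2 - z / (2 * m) := by
    rw [← sum_mul, sum_range_natCast]
    field_simp
  have h_split : ∑ i ∈ range m, Complex.log (1 - i * (z / m ^ 2)) + ρ / 2 =
      -((z - ρ) / 2) + z / (2 * m) +
        ∑ i ∈ range m, (Complex.log (1 - i * (z / m ^ 2)) + i * (z / m ^ 2)) := by
    rw [sum_add_distrib, h_sum]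
    ring
  have h_logs : ‖∑ i ∈ range m, (Complex.log (1 - i * (z / m ^ 2)) + i * (z / m ^ 2))‖ ≤
      ‖z‖ ^ 2 / m := by
    calc _ ≤ ∑ i ∈ range m, (‖z‖ / m) ^ 2 := norm_sum_le_of_le _ fun i hi =>
          (norm_log_one_sub_add_le ((norm_natCast_mul_div_sq_le z (mem_range.1 hi)).trans hz)).trans
            (by gcongr; exact norm_natCast_mul_div_sq_le z (mem_range.1 hi))
      _ = ‖z‖ ^ 2 / m := by
          rw [sum_const, card_range, nsmul_eq_mul]
          field_simp
  rw [h_split]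
  refine norm_add₃_le.trans (add_le_add (add_le_add (le_of_eq ?_) (le_of_eq ?_)) h_logs)
  · rw [norm_neg, norm_div, RCLike.norm_ofNat]
  · rw [norm_div, norm_mul, RCLike.norm_ofNat, Complex.norm_natCast]

theorem norm_prod_one_sub_sub_exp_le {m : ℕ} (hm : 0 < m) {z ρ : ℂ} {D : ℝ} (hz : ‖z‖ / m ≤ 1 / 2)
    (hD : ‖z - ρ‖ / 2 + ‖z‖ / (2 * m) + ‖z‖ ^ 2 / m ≤ D) (hD_one : D ≤ 1) :
    ‖∏ i ∈ range m, (1 - i * (z / m ^ 2)) - Complex.exp (-(ρ / 2))‖ ≤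
      2 * D * ‖Complex.exp (-(ρ / 2))‖ := by
  set S := ∑ i ∈ range m, Complex.log (1 - i * (z / m ^ 2)) with hS
  have h_prod : ∏ i ∈ range m, (1 - i * (z / m ^ 2)) = Complex.exp S := by
    rw [hS, Complex.exp_sum]
    refine prod_congr rfl fun i hi => (Complex.exp_log fun h_zero => ?_).symm
    have h_norm := (norm_natCast_mul_div_sq_le z (mem_range.1 hi)).trans hz
    rw [← sub_eq_zero.1 h_zero, norm_one] at h_norm
    norm_num at h_norm
  have hS_le : ‖S + ρ / 2‖ ≤ D := (norm_sum_log_one_sub_add_le hm hz ρ).trans hD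
  have h_factor : Complex.exp S - Complex.exp (-(ρ / 2)) =
      (Complex.exp (S + ρ / 2) - 1) * Complex.exp (-(ρ / 2)) := by
    rw [sub_mul, ← Complex.exp_add]
    ring_nf
  rw [h_prod, h_factor, norm_mul]
  gcongr
  linarith [Complex.norm_exp_sub_one_le (hS_le.trans hD_one)]

theorem sum_mul_pow_add_norm_exp_le {m : ℕ} (hm : 0 < m) {ρ x : ℝ} (hρ : 0 ≤ ρ) (hx : 0 ≤ x) :
    ∑ j ∈ range (m + 1), ‖fallCoeff m j / (m : ℂ) ^ (2 * j)‖ * x ^ j +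
      ‖Complex.exp (-(ρ / 2))‖ ≤ 2 * Real.exp (1 / 2 * x) := by
  have h_norm : ‖Complex.exp (-(ρ / 2))‖ ≤ Real.exp (1 / 2 * x) := by
    rw [Complex.norm_exp]
    gcongr
    norm_num
    linarith
  linarith [sum_norm_fallCoeff_div_le hm hx]

theorem norm_sum_fallCoeff_sub_exp_le {m : ℕ} (hm : 0 < m) {ρ β D : ℝ} {z : ℂ} (hρ : 0 ≤ ρ)
    (hβ : β ≤ 3) (hρm : 4 * ρ / m ≤ 1 / 2)
    (hD : β * ρ / 2 + 4 * ρ / (2 * m) + (4 * ρ) ^ 2 / m ≤ D) (hD_one : D ≤ 1)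
    (hz : ‖z - ρ‖ ≤ β * ρ) :
    ‖∑ j ∈ range (m + 1), fallCoeff m j / (m : ℂ) ^ (2 * j) * z ^ j - Complex.exp (-(ρ / 2))‖ ≤
      2 * D * Real.exp (-(ρ / 2)) := by
  have hz_norm : ‖z‖ ≤ 4 * ρ := by
    have h := norm_le_insert' z (ρ : ℂ)
    rw [Complex.norm_real, Real.norm_of_nonneg hρ] at h
    nlinarith
  have h_exp : ‖Complex.exp (-(ρ / 2))‖ = Real.exp (-(ρ / 2)) := by
    rw [Complex.norm_exp]
    norm_num
  rw [sum_fallCoeff_div_mul_pow, ← h_exp]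
  exact norm_prod_one_sub_sub_exp_le hm (hρm.trans' (by gcongr)) (hD.trans' (by gcongr)) hD_one

-- Writing `(m - j)! / m!` twice as a negative Gamma moment turns `simpleFactor m` into a twofold
-- Gamma average of `z ↦ ∏ i < m, (1 - i * z / m ^ 2)`, which is close to `exp (-z / 2)`.
theorem norm_simpleFactor_sub_exp_le {m : ℕ} (hm : 0 < m) {ρ α δ D : ℝ} {z : ℂ} (hρ : 0 ≤ ρ)
    (hδ : 0 ≤ δ) (hδ_half : δ ≤ 1 / 2) (hαδ : α + 4 * δ ≤ 1) (hρm : 4 * ρ / m ≤ 1 / 2)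
    (hD : (α + 4 * δ + 4 * δ) * ρ / 2 + 4 * ρ / (2 * m) + (4 * ρ) ^ 2 / m ≤ D) (hD_one : D ≤ 1)
    (hz : ‖z - ρ‖ ≤ α * ρ) :
    ‖simpleFactor m z - Complex.exp (-(ρ / 2))‖ ≤ 2 * D * Real.exp (-(ρ / 2)) +
      16 * Real.exp (18 * ρ) * Real.exp (-(m * δ ^ 2 / 4)) := by
  have h_majorant (x : ℝ) (hx : 0 ≤ x) := sum_mul_pow_add_norm_exp_le hm hρ hx
  have h_majorant_weighted (x : ℝ) (hx : 0 ≤ x) :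
      ∑ j ∈ range (m + 1), ‖fallCoeff m j / (m : ℂ) ^ (2 * j) * gammaWeight m j‖ * x ^ j +
        ‖Complex.exp (-(ρ / 2))‖ ≤ 2 * Real.exp (3 / 2 * x) :=
    (add_le_add_left (sum_norm_mul_gammaWeight_le _ m hx) _).trans
      ((h_majorant (3 * x) (by positivity)).trans_eq (by ring_nf))
  have h_once (y : ℂ) (hy : ‖y - ρ‖ ≤ (α + 4 * δ) * ρ) :=
    norm_sum_mul_gammaWeight_sub_le hm hαδ hδ hδ_half hρ (by norm_num) h_majorant
      (fun _ => norm_sum_fallCoeff_sub_exp_le hm hρ (by linarith) hρm hD hD_one) hy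
  rw [simpleFactor_eq hm]
  refine (norm_sum_mul_gammaWeight_sub_le hm (by linarith) hδ hδ_half hρ (by norm_num)
    h_majorant_weighted h_once hz).trans ?_
  have h_mono : Real.exp (12 * (1 / 2) * ρ) ≤ Real.exp (18 * ρ) := by
    gcongr
    linarith
  calc _ = 2 * D * Real.exp (-(ρ / 2)) + (8 * Real.exp (12 * (1 / 2) * ρ) +
        8 * Real.exp (18 * ρ)) * Real.exp (-(m * δ ^ 2 / 4)) := by ring_nf
    _ ≤ _ := by
        gcongr
        linarith

theorem norm_simpleFactor_mul_exp_sub_one_le {m : ℕ} (hm : 0 < m) {ρ α δ D : ℝ} {z : ℂ}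
    (hρ : 0 ≤ ρ) (hδ : 0 ≤ δ) (hδ_half : δ ≤ 1 / 2) (hαδ : α + 4 * δ ≤ 1)
    (hρm : 4 * ρ / m ≤ 1 / 2)
    (hD : (α + 4 * δ + 4 * δ) * ρ / 2 + 4 * ρ / (2 * m) + (4 * ρ) ^ 2 / m ≤ D) (hD_one : D ≤ 1)
    (hz : ‖z - ρ‖ ≤ α * ρ) :
    ‖simpleFactor m z * Real.exp (ρ / 2) - 1‖ ≤
      2 * D + 16 * Real.exp (19 * ρ) * Real.exp (-(m * δ ^ 2 / 4)) := by
  have h_factor : simpleFactor m z * Real.exp (ρ / 2) - 1 =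
      (simpleFactor m z - Complex.exp (-(ρ / 2))) * Real.exp (ρ / 2) := by
    rw [sub_mul]
    simp [← Complex.exp_add]
  rw [h_factor, norm_mul, Complex.norm_real, Real.norm_of_nonneg (Real.exp_pos _).le]
  calc _ ≤ (2 * D * Real.exp (-(ρ / 2)) + 16 * Real.exp (18 * ρ) *
        Real.exp (-(m * δ ^ 2 / 4))) * Real.exp (ρ / 2) := by
        gcongr
        exact norm_simpleFactor_sub_exp_le hm hρ hδ hδ_half hαδ hρm hD hD_one hz
    _ = 2 * D * Real.exp (-(ρ / 2) + ρ / 2) +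
          16 * Real.exp (18 * ρ + ρ / 2) * Real.exp (-(m * δ ^ 2 / 4)) := by
        rw [Real.exp_add, Real.exp_add]
        ring
    _ ≤ _ := by
        rw [neg_add_cancel, Real.exp_zero, mul_one]
        gcongr
        linarith

end SimpleFactor

/-! ### The zero-truncated Poisson distribution -/

section TruncPoisson

open MeasureTheory Complex Finset
open scoped Real

theorem norm_exp_mul_I_sub_le (x : ℝ) :
    ‖exp (x * I) - (1 + x * I - x ^ 2 / 2)‖ ≤ 4 * |x| ^ 3 := by
  have h_norm : ‖(x : ℂ) * I‖ = |x| := by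
    rw [norm_mul, norm_I, mul_one, norm_real, Real.norm_eq_abs]
  rcases le_total |x| 1 with h | h
  · have h_taylor := norm_exp_sub_sum_le_norm_mul_exp (x * I) 3
    have h_sum : ∑ j ∈ range 3, ((x : ℂ) * I) ^ j / j.factorial = 1 + x * I - x ^ 2 / 2 := by
      simp only [sum_range_succ, range_zero, sum_empty, mul_pow, I_sq, Nat.factorial]
      norm_num
      ring
    rw [h_sum, h_norm] at h_taylor
    have h_exp : Real.exp |x| ≤ 4 := by linarith [Real.exp_le_exp.2 h, Real.exp_one_lt_d9]
    calc _ ≤ |x| ^ 3 * 4 := h_taylor.trans (by gcongr)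
      _ = _ := mul_comm _ _
  · have h_sq : |x| ≤ |x| ^ 2 := by nlinarith
    have h_cube : |x| ^ 2 ≤ |x| ^ 3 := by nlinarith [sq_nonneg |x|]
    calc _ ≤ ‖exp (x * I)‖ + (‖(1 : ℂ)‖ + ‖(x : ℂ) * I‖ + ‖(x : ℂ) ^ 2 / 2‖) :=
          (norm_sub_le _ _).trans
            (by gcongr; exact (norm_sub_le _ _).trans (by gcongr; exact norm_add_le _ _))
      _ = 1 + (1 + |x| + |x| ^ 2 / 2) := by
          rw [norm_exp_ofReal_mul_I, norm_one, h_norm, norm_div, norm_pow, norm_real,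
            Real.norm_eq_abs, RCLike.norm_ofNat]
      _ ≤ 4 * |x| ^ 3 := by linarith

theorem norm_charFun_sub_le {p x y : ℕ → ℝ} {v M θ : ℝ} {χ : ℂ} (hp : ∀ k, 0 ≤ p k)
    (hxy : ∀ k, |x k| ^ 3 ≤ y k) (h_one : HasSum p 1) (h_mean : HasSum (fun k => p k * x k) 0)
    (h_var : HasSum (fun k => p k * x k ^ 2) v) (hM : HasSum (fun k => p k * y k) M)
    (hχ : HasSum (fun k => p k * exp (θ * x k * I)) χ) :
    ‖χ - (1 - v * θ ^ 2 / 2)‖ ≤ 4 * |θ| ^ 3 * M := by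
  have h_sum : HasSum (fun k => p k * (exp ((θ * x k : ℝ) * I) -
      (1 + (θ * x k : ℝ) * I - (θ * x k : ℝ) ^ 2 / 2))) (χ - (1 - v * θ ^ 2 / 2)) := by
    have h := hχ.sub (((hasSum_ofReal.2 h_one).add ((hasSum_ofReal.2 h_mean).mul_left (θ * I))).sub
      ((hasSum_ofReal.2 h_var).mul_left (θ ^ 2 / 2 : ℂ)))
    convert! h using 1
    · ext k
      push_cast
      ring
    · push_cast
      ring
  refine h_sum.norm_le_of_bounded (hM.mul_left _) fun k => ?_
  rw [norm_mul, norm_real, Real.norm_of_nonneg (hp k)]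
  calc _ ≤ p k * (4 * |θ * x k| ^ 3) := by
        gcongr
        · exact hp k
        · exact norm_exp_mul_I_sub_le _
    _ = 4 * |θ| ^ 3 * (p k * |x k| ^ 3) := by
        rw [abs_mul]
        ring
    _ ≤ 4 * |θ| ^ 3 * (p k * y k) := by
        gcongr
        · exact hp k
        · exact hxy k

/-- The zero-truncated Poisson distribution: the probability of the value `k + 1`. -/
noncomputable def truncPoisson (lam : ℝ) (k : ℕ) : ℝ :=
  lam ^ (k + 1) / (k + 1).factorial / (Real.exp lam - 1)

theorem hasSum_pow_div_factorial_mul_descFactorial (x : ℝ) (r : ℕ) :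
    HasSum (fun k : ℕ => x ^ k / k.factorial * (k.descFactorial r : ℝ)) (x ^ r * Real.exp x) := by
  rw [← hasSum_nat_add_iff' r, sum_eq_zero fun i hi => by
    rw [Nat.descFactorial_of_lt (mem_range.1 hi), Nat.cast_zero, mul_zero], sub_zero]
  have h := (NormedSpace.expSeries_div_hasSum_exp x).mul_left (x ^ r)
  rw [← Real.exp_eq_exp_ℝ] at h
  refine h.congr_fun fun k => ?_
  have h_fac : ((k + r).factorial : ℝ) = k.factorial * ((k + r).descFactorial r : ℝ) := by
    rw [← Nat.factorial_mul_descFactorial (Nat.le_add_left r k), Nat.add_sub_cancel]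
    push_cast
    rfl
  have h_desc : ((k + r).descFactorial r : ℝ) ≠ 0 :=
    Nat.cast_ne_zero.2 (Nat.descFactorial_eq_zero_iff_lt.not.2 (by lia))
  rw [h_fac, pow_add]
  field_simp

theorem hasSum_truncPoisson_mul {f : ℕ → ℂ} {S : ℂ} (lam : ℝ)
    (h : HasSum (fun k : ℕ => (lam ^ k / k.factorial : ℝ) * f k) S) :
    HasSum (fun k => truncPoisson lam k * f (k + 1)) ((S - f 0) / (exp lam - 1)) := by
  have h_shift := ((hasSum_nat_add_iff' 1).2 h).div_const (exp lam - 1 : ℂ)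
  simp only [range_one, sum_singleton, pow_zero, Nat.factorial_zero, Nat.cast_one, div_one,
    ofReal_one, one_mul] at h_shift
  refine h_shift.congr_fun fun k => ?_
  rw [truncPoisson]
  push_cast
  ring

theorem hasSum_truncPoisson_mul_descFactorial (lam : ℝ) (r : ℕ) :
    HasSum (fun k => truncPoisson lam k * ((k + 1).descFactorial r : ℝ))
      ((lam ^ r * Real.exp lam - (Nat.descFactorial 0 r : ℝ)) / (Real.exp lam - 1)) := by
  have h := hasSum_ofReal.2 (hasSum_pow_div_factorial_mul_descFactorial lam r)
  simp only [ofReal_mul _ (Nat.cast _)] at h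
  rw [← hasSum_ofReal]
  exact_mod_cast hasSum_truncPoisson_mul lam h

theorem hasSum_truncPoisson_mul_exp (lam θ : ℝ) :
    HasSum (fun k => truncPoisson lam k * exp (θ * ((k + 1 : ℕ) : ℝ) * I)) (chi lam θ) := by
  have h := NormedSpace.expSeries_div_hasSum_exp (lam * exp (θ * I))
  rw [← exp_eq_exp_ℂ] at h
  have h_exp := hasSum_truncPoisson_mul (f := fun k => exp (θ * (k : ℝ) * I)) lam
    (h.congr_fun fun k => ?_)
  · simpa [chi] using h_exp
  · rw [mul_pow, ← exp_nat_mul]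
    push_cast
    ring_nf

theorem IsParam.hasSum_truncPoisson {c lam : ℝ} (h : IsParam c lam) :
    HasSum (truncPoisson lam) 1 := by
  have h_sum := hasSum_truncPoisson_mul_descFactorial lam 0
  simpa [(exp_sub_one_pos h.1).ne'] using h_sum

theorem IsParam.hasSum_truncPoisson_mul_descFactorial {c lam : ℝ} (h : IsParam c lam) (r : ℕ) :
    HasSum (fun k => truncPoisson lam k * ((k + 1).descFactorial (r + 1) : ℝ)) (lam ^ r * c) := by
  have h_sum := Dicore.hasSum_truncPoisson_mul_descFactorial lam (r + 1)
  rwa [Nat.zero_descFactorial_succ, Nat.cast_zero, sub_zero, pow_succ, mul_assoc, mul_div_assoc,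
    ← h.2] at h_sum

theorem IsParam.hasSum_truncPoisson_mul_sub {c lam : ℝ} (h : IsParam c lam) :
    HasSum (fun k => truncPoisson lam k * (((k + 1 : ℕ) : ℝ) - c)) 0 := by
  have h_sum := (h.hasSum_truncPoisson_mul_descFactorial 0).sub (h.hasSum_truncPoisson.mul_right c)
  convert! h_sum using 1
  · ext k
    rw [Nat.descFactorial_one]
    ring
  · ring

theorem IsParam.hasSum_truncPoisson_mul_sub_sq {c lam : ℝ} (h : IsParam c lam) :
    HasSum (fun k => truncPoisson lam k * (((k + 1 : ℕ) : ℝ) - c) ^ 2) (c * (1 + lam - c)) := by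
  have h_sum := ((h.hasSum_truncPoisson_mul_descFactorial 1).add
    ((h.hasSum_truncPoisson_mul_descFactorial 0).mul_right (1 - 2 * c))).add
      (h.hasSum_truncPoisson.mul_right (c ^ 2))
  convert! h_sum using 1
  · ext k
    simp only [Nat.descFactorial_succ, Nat.descFactorial_zero, Nat.add_sub_cancel, Nat.sub_zero]
    push_cast
    ring
  · ring

theorem abs_sub_pow_three_le {c lam : ℝ} (hc : 1 ≤ c) (hlam : c ≤ 1 + lam) (k : ℕ) :
    |((k + 1 : ℕ) : ℝ) - c| ^ 3 ≤
      ((k + 1).descFactorial 3 : ℝ) + ((k + 1).descFactorial 2 : ℝ) + lam ^ 3 := by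
  have hlam_nonneg : 0 ≤ lam := by linarith
  rcases le_total ((k + 1 : ℕ) : ℝ) c with h | h
  · calc |((k + 1 : ℕ) : ℝ) - c| ^ 3 ≤ lam ^ 3 := by
          gcongr
          rw [abs_of_nonpos (by linarith)]
          push_cast
          linarith [k.cast_nonneg (α := ℝ)]
      _ ≤ _ := le_add_of_nonneg_left (by positivity)
  · have h_cube : (k : ℝ) ^ 3 ≤ ((k + 1).descFactorial 3 : ℝ) + ((k + 1).descFactorial 2 : ℝ) := by
      rcases k with _ | k
      · simp
      · simp only [Nat.descFactorial_succ, Nat.descFactorial_zero, Nat.add_sub_cancel, Nat.sub_zero,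
          Nat.reduceSubDiff]
        push_cast
        nlinarith [k.cast_nonneg (α := ℝ)]
    calc |((k + 1 : ℕ) : ℝ) - c| ^ 3 ≤ (k : ℝ) ^ 3 := by
          gcongr
          rw [abs_of_nonneg (by linarith)]
          push_cast
          linarith
      _ ≤ _ := h_cube.trans (le_add_of_nonneg_right (by positivity))

theorem IsParam.norm_chi_mul_exp_sub_le {c lam : ℝ} (h : IsParam c lam) (θ : ℝ) :
    ‖chi lam θ * exp (-(c * θ * I)) - (1 - (c * (1 + lam - c) : ℝ) * θ ^ 2 / 2)‖ ≤
      8 * |θ| ^ 3 * (lam * (1 + lam) ^ 2) := by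
  have hlam := h.1
  have h_nonneg (k : ℕ) : 0 ≤ truncPoisson lam k :=
    div_nonneg (by positivity) (exp_sub_one_pos hlam).le
  have h_third : HasSum (fun k => truncPoisson lam k * (((k + 1).descFactorial 3 : ℝ) +
      ((k + 1).descFactorial 2 : ℝ) + lam ^ 3)) (lam ^ 2 * c + lam ^ 1 * c + 1 * lam ^ 3) := by
    simp_rw [mul_add]
    exact ((h.hasSum_truncPoisson_mul_descFactorial 2).add
      (h.hasSum_truncPoisson_mul_descFactorial 1)).add (h.hasSum_truncPoisson.mul_right _)
  have h_centred : HasSum (fun k => truncPoisson lam k *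
      exp (θ * (((k + 1 : ℕ) : ℝ) - c : ℝ) * I)) (chi lam θ * exp (-(c * θ * I))) := by
    refine ((hasSum_truncPoisson_mul_exp lam θ).mul_right _).congr_fun fun k => ?_
    rw [mul_assoc (_ : ℂ) (exp _) (exp _), ← exp_add]
    push_cast
    ring_nf
  refine (norm_charFun_sub_le h_nonneg (abs_sub_pow_three_le h.one_lt.le h.le_one_add)
    h.hasSum_truncPoisson h.hasSum_truncPoisson_mul_sub h.hasSum_truncPoisson_mul_sub_sq h_third
    h_centred).trans ?_
  calc _ ≤ 4 * |θ| ^ 3 * (lam ^ 2 * (1 + lam) + lam ^ 1 * (1 + lam) + 1 * lam ^ 3) := by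
        gcongr
        exacts [h.le_one_add, h.le_one_add]
    _ ≤ 4 * |θ| ^ 3 * (2 * (lam * (1 + lam) ^ 2)) := by
        gcongr
        nlinarith [mul_pos hlam hlam]
    _ = _ := by ring

theorem abs_exp_neg_sub_one_add_le {u : ℝ} (hu : 0 ≤ u) :
    |Real.exp (-u) - (1 - u)| ≤ u ^ 2 / 2 := by
  rw [abs_of_nonneg (by linarith [Real.add_one_le_exp (-u)]), Real.exp_neg, sub_le_iff_le_add,
    inv_le_iff_one_le_mul₀ (Real.exp_pos u)]
  nlinarith [Real.quadratic_le_exp_of_nonneg hu, sq_nonneg (u - 1), pow_nonneg hu 4]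

theorem IsParam.norm_chi_mul_exp_sub_exp_le {c lam φ : ℝ} (h : IsParam c lam) (hφ : |φ| ≤ π) :
    ‖chi lam φ * exp (-(c * φ * I)) - Real.exp (-(c * (1 + lam - c) * φ ^ 2 / 2))‖ ≤
      9 * (lam * (1 + lam) ^ 2) * |φ| ^ 3 := by
  have hlam := h.1
  have hv_pos : 0 ≤ c * (1 + lam - c) := by linarith [h.half_le_variance]
  have h_gauss : ‖(1 - (c * (1 + lam - c) : ℝ) * φ ^ 2 / 2 : ℂ) -
      Real.exp (-(c * (1 + lam - c) * φ ^ 2 / 2))‖ ≤ lam * (1 + lam) ^ 2 * |φ| ^ 3 := by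
    have h_exp := abs_exp_neg_sub_one_add_le (u := c * (1 + lam - c) * φ ^ 2 / 2) (by positivity)
    rw [abs_sub_comm, ← Real.norm_eq_abs, ← norm_real] at h_exp
    calc _ ≤ (c * (1 + lam - c) * φ ^ 2 / 2) ^ 2 / 2 := by
          convert h_exp using 2
          push_cast
          ring
      _ = (c * (1 + lam - c)) ^ 2 * (|φ| / 8) * |φ| ^ 3 := by
          rw [← sq_abs φ]
          ring
      _ ≤ lam ^ 2 * 1 * |φ| ^ 3 := by
          gcongr
          · exact h.variance_le
          · linarith [Real.pi_lt_four]
      _ ≤ _ := by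
          refine mul_le_mul_of_nonneg_right ?_ (by positivity)
          nlinarith [mul_pos hlam hlam, mul_pos hlam (mul_pos hlam hlam)]
  refine (norm_sub_le_norm_sub_add_norm_sub _ _ _).trans
    ((add_le_add (h.norm_chi_mul_exp_sub_le φ) h_gauss).trans_eq ?_)
  ring

end TruncPoisson

/-! ### The local limit theorem -/

section LocalLimit

open MeasureTheory Complex Finset
open scoped Real

theorem norm_pow_sub_pow_le {z w : ℂ} {r : ℝ} (hz : ‖z‖ ≤ r) (hw : ‖w‖ ≤ r) (n : ℕ) :
    ‖z ^ n - w ^ n‖ ≤ n * r ^ (n - 1) * ‖z - w‖ := by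
  refine (convex_closedBall 0 r).norm_image_sub_le_of_norm_deriv_le (𝕜 := ℂ)
    (f := (· ^ n)) (fun x _ => differentiableAt_pow n) (fun x hx => ?_)
    (mem_closedBall_zero_iff.2 hw) (mem_closedBall_zero_iff.2 hz)
  rw [deriv_pow_field, norm_mul, norm_natCast, norm_pow]
  gcongr
  exact mem_closedBall_zero_iff.1 hx

theorem integrable_abs_pow_three_mul_exp_neg_mul_sq {b : ℝ} (hb : 0 < b) :
    Integrable fun x : ℝ => |x| ^ 3 * Real.exp (-b * x ^ 2) := by
  refine (integrable_rpow_mul_exp_neg_mul_sq hb (s := 3) (by norm_num)).norm.congr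
    (ae_of_all _ fun x => ?_)
  simp only [norm_mul, Real.norm_eq_abs, Real.abs_exp, ← abs_pow, ← Real.rpow_natCast,
    Nat.cast_ofNat]

theorem integral_abs_pow_three_mul_exp_neg_mul_sq {b : ℝ} (hb : 0 < b) :
    ∫ x : ℝ, |x| ^ 3 * Real.exp (-b * x ^ 2) = 1 / b ^ 2 := by
  have h_abs := integral_comp_abs (f := fun x : ℝ => x ^ 3 * Real.exp (-b * x ^ 2))
  have h_gamma := _root_.integral_rpow_mul_exp_neg_mul_rpow (p := 2) (q := 3) (b := b)
    (by norm_num) (by norm_num) hb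
  simp only [sq_abs] at h_abs
  simp only [← Real.rpow_natCast, Nat.cast_ofNat] at h_abs ⊢
  rw [h_abs, h_gamma]
  norm_num
  ring

theorem norm_mul_exp_neg_mul_I (z : ℂ) (x y : ℝ) : ‖z * exp (-(x * y * I))‖ = ‖z‖ := by
  rw [norm_mul, norm_exp]
  simp

theorem IsParam.norm_chi_pow_sub_exp_le {c lam φ : ℝ} {n : ℕ} (h : IsParam c lam) (hn : 2 ≤ n)
    (hφ : |φ| ≤ π) :
    ‖(chi lam φ * exp (-(c * φ * I))) ^ n - Real.exp (-(n * (c * (1 + lam - c)) / 2) * φ ^ 2)‖ ≤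
      9 * (n * lam * (1 + lam) ^ 2) * (|φ| ^ 3 * Real.exp (-(n * lam / (2 * π ^ 2)) * φ ^ 2)) := by
  have hlam := h.1
  have hpi := Real.pi_gt_three
  have hn' : (2 : ℝ) ≤ n := Nat.ofNat_le_cast.2 hn
  have hz : ‖chi lam φ * exp (-(c * φ * I))‖ ≤ Real.exp (-(lam * φ ^ 2 / π ^ 2)) :=
    (norm_mul_exp_neg_mul_I _ _ _).trans_le (norm_chi_le hlam hφ)
  have hw : ‖(Real.exp (-(c * (1 + lam - c) * φ ^ 2 / 2)) : ℂ)‖ ≤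
      Real.exp (-(lam * φ ^ 2 / π ^ 2)) := by
    rw [norm_real, Real.norm_of_nonneg (Real.exp_pos _).le]
    refine Real.exp_le_exp.2 (neg_le_neg ?_)
    calc lam * φ ^ 2 / π ^ 2 ≤ lam * φ ^ 2 / 4 := by gcongr; nlinarith
      _ = lam / 2 * φ ^ 2 / 2 := by ring
      _ ≤ _ := by gcongr; exact h.half_le_variance
  have h_pow : Real.exp (-(lam * φ ^ 2 / π ^ 2)) ^ (n - 1) ≤
      Real.exp (-(n * lam / (2 * π ^ 2)) * φ ^ 2) := by
    rw [← Real.exp_nat_mul, Nat.cast_pred (by lia), Real.exp_le_exp]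
    calc ((n : ℝ) - 1) * -(lam * φ ^ 2 / π ^ 2) = -((n - 1) * (lam * φ ^ 2 / π ^ 2)) := by ring
      _ ≤ -(n / 2 * (lam * φ ^ 2 / π ^ 2)) := by gcongr; linarith
      _ = _ := by ring
  calc _ = ‖(chi lam φ * exp (-(c * φ * I))) ^ n -
        (Real.exp (-(c * (1 + lam - c) * φ ^ 2 / 2)) : ℂ) ^ n‖ := by
        rw [← ofReal_pow, ← Real.exp_nat_mul]
        ring_nf
    _ ≤ n * Real.exp (-(n * lam / (2 * π ^ 2)) * φ ^ 2) * (9 * (lam * (1 + lam) ^ 2) * |φ| ^ 3) :=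
        (norm_pow_sub_pow_le hz hw n).trans (by gcongr; exact h.norm_chi_mul_exp_sub_exp_le hφ)
    _ = _ := by ring

theorem IsParam.exp_neg_le_of_pi_le {c lam φ : ℝ} {n : ℕ} (h : IsParam c lam)
    (hn : 1 ≤ n * lam) (hφ : π ≤ |φ|) :
    Real.exp (-(n * (c * (1 + lam - c)) / 2) * φ ^ 2) ≤
      9 * (n * lam * (1 + lam) ^ 2) * (|φ| ^ 3 * Real.exp (-(n * lam / (2 * π ^ 2)) * φ ^ 2)) := by
  have hlam := h.1
  have hpi := Real.pi_gt_three
  have h_const : 1 ≤ 9 * (n * lam * (1 + lam) ^ 2) * |φ| ^ 3 :=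
    one_le_mul_of_one_le_of_one_le (one_le_mul_of_one_le_of_one_le (by norm_num)
      (one_le_mul_of_one_le_of_one_le hn (one_le_pow₀ (by linarith)))) (one_le_pow₀ (by linarith))
  have h_exp : Real.exp (-(n * (c * (1 + lam - c)) / 2) * φ ^ 2) ≤
      Real.exp (-(n * lam / (2 * π ^ 2)) * φ ^ 2) := by
    refine Real.exp_le_exp.2 (mul_le_mul_of_nonneg_right (neg_le_neg ?_) (sq_nonneg φ))
    calc n * lam / (2 * π ^ 2) ≤ n * lam / 4 := by gcongr; nlinarith
      _ = n * (lam / 2) / 2 := by ring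
      _ ≤ _ := by gcongr; exact h.half_le_variance
  rw [← mul_assoc (9 * _)]
  exact h_exp.trans (le_mul_of_one_le_left (Real.exp_pos _).le h_const)

theorem IsParam.norm_indicator_chi_pow_sub_exp_le {c lam : ℝ} {n : ℕ} (h : IsParam c lam)
    (hn : 2 ≤ n) (hn_lam : 1 ≤ n * lam) (φ : ℝ) :
    ‖(Set.Ioc (-π) π).indicator (fun φ : ℝ => (chi lam φ * exp (-(c * φ * I))) ^ n) φ -
      Real.exp (-(n * (c * (1 + lam - c)) / 2) * φ ^ 2)‖ ≤
      9 * (n * lam * (1 + lam) ^ 2) * (|φ| ^ 3 * Real.exp (-(n * lam / (2 * π ^ 2)) * φ ^ 2)) := by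
  by_cases hφ : φ ∈ Set.Ioc (-π) π
  · rw [Set.indicator_of_mem hφ]
    exact h.norm_chi_pow_sub_exp_le hn (abs_le.2 ⟨hφ.1.le, hφ.2⟩)
  · rw [Set.indicator_of_notMem hφ, zero_sub, norm_neg, norm_real,
      Real.norm_of_nonneg (Real.exp_pos _).le]
    refine h.exp_neg_le_of_pi_le hn_lam (not_lt.1 fun hlt => hφ ?_)
    exact ⟨(abs_lt.1 hlt).1, (abs_lt.1 hlt).2.le⟩

-- Local limit theorem: if `c * n` is an integer, the integral is `2 * π` times the probability that
-- `n` independent zero-truncated Poisson variables have sum `c * n`.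
theorem IsParam.norm_integral_chi_pow_sub_le {c lam : ℝ} {n : ℕ} (h : IsParam c lam) (hn : 2 ≤ n)
    (hn_lam : 1 ≤ n * lam) :
    ‖(∫ φ, (chi lam φ * exp (-(c * φ * I))) ^ n ∂circleMeasure) -
      √(π / (n * (c * (1 + lam - c)) / 2))‖ ≤ 36 * π ^ 4 * ((1 + lam) ^ 2 / (n * lam)) := by
  have hlam := h.1
  have hv : 0 < n * (c * (1 + lam - c)) / 2 := by
    have hv_lam := mul_le_mul_of_nonneg_left h.half_le_variance n.cast_nonneg
    linarith
  set s : Set ℝ := Set.Ioc (-π) π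
  set f : ℝ → ℂ := fun φ => (chi lam φ * exp (-(c * φ * I))) ^ n
  have hf_int : Integrable (s.indicator f) :=
    IntegrableOn.integrable_indicator (integrable_circleMeasure (by fun_prop)) measurableSet_Ioc
  have h_gauss : Integrable fun φ : ℝ =>
      ((Real.exp (-(n * (c * (1 + lam - c)) / 2) * φ ^ 2) : ℝ) : ℂ) :=
    (integrable_exp_neg_mul_sq hv).ofReal
  have h_diff : (∫ φ, f φ ∂circleMeasure) - √(π / (n * (c * (1 + lam - c)) / 2)) =
      ∫ φ, (s.indicator f φ - (Real.exp (-(n * (c * (1 + lam - c)) / 2) * φ ^ 2) : ℝ)) := by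
    rw [integral_sub hf_int h_gauss, integral_complex_ofReal, integral_gaussian,
      integral_indicator measurableSet_Ioc, circleMeasure]
  rw [h_diff]
  have hb : 0 < n * lam / (2 * π ^ 2) := by positivity
  refine (norm_integral_le_of_norm_le ((integrable_abs_pow_three_mul_exp_neg_mul_sq hb).const_mul _)
    (ae_of_all _ (h.norm_indicator_chi_pow_sub_exp_le hn hn_lam))).trans_eq ?_
  rw [integral_const_mul, integral_abs_pow_three_mul_exp_neg_mul_sq hb]
  field_simp
  ring

end LocalLimit

/-! ### The double integral -/

section DoubleIntegral

open MeasureTheory Complex Finset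
open scoped Real

theorem norm_chi_pow_mul_chi_pow_le {lam φ ψ : ℝ} (hlam : 0 < lam) (hφ : |φ| ≤ π) (hψ : |ψ| ≤ π)
    (n : ℕ) :
    ‖chi lam φ ^ n * chi lam ψ ^ n‖ ≤ Real.exp (-(n * lam / π ^ 2 * (φ ^ 2 + ψ ^ 2))) := by
  rw [norm_mul, norm_pow, norm_pow]
  calc _ ≤ Real.exp (-(lam * φ ^ 2 / π ^ 2)) ^ n * Real.exp (-(lam * ψ ^ 2 / π ^ 2)) ^ n := by
        gcongr
        exacts [norm_chi_le hlam hφ, norm_chi_le hlam hψ]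
    _ = _ := by
        rw [← Real.exp_nat_mul, ← Real.exp_nat_mul, ← Real.exp_add]
        ring_nf

theorem norm_simpleFactor_mul_exp_sub_one_le_exp {m : ℕ} (hm : 0 < m) (z : ℂ) :
    ‖simpleFactor m z * Real.exp (‖z‖ / 2) - 1‖ ≤ 2 * Real.exp (6 * ‖z‖) := by
  have h_exp : ‖simpleFactor m z‖ * Real.exp (‖z‖ / 2) ≤ Real.exp (6 * ‖z‖) := by
    calc _ ≤ Real.exp (5 * ‖z‖) * Real.exp (‖z‖ / 2) := by
          gcongr
          exact norm_simpleFactor_le hm z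
      _ ≤ _ := by
          rw [← Real.exp_add, Real.exp_le_exp]
          linarith [norm_nonneg z]
  have h_one : 1 ≤ Real.exp (6 * ‖z‖) := Real.one_le_exp (by positivity)
  refine (norm_sub_le _ _).trans ?_
  rw [norm_mul, norm_real, Real.norm_of_nonneg (Real.exp_pos _).le, norm_one]
  linarith

theorem norm_ofReal_mul_exp_mul_I {r : ℝ} (hr : 0 ≤ r) (x : ℝ) : ‖r * exp (x * I)‖ = r := by
  rw [norm_mul, norm_exp_ofReal_mul_I, mul_one, norm_real, Real.norm_of_nonneg hr]

theorem norm_ofReal_mul_exp_mul_I_sub_le {r : ℝ} (hr : 0 ≤ r) (x : ℝ) :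
    ‖r * exp (x * I) - r‖ ≤ |x| * r := by
  rw [← mul_sub_one, norm_mul, norm_real, Real.norm_of_nonneg hr, mul_comm, mul_comm (x : ℂ)]
  gcongr
  exact Real.norm_exp_I_mul_ofReal_sub_one_le

theorem exp_neg_le_one_div {x : ℝ} (hx : 0 < x) : Real.exp (-x) ≤ 1 / x := by
  rw [Real.exp_neg, one_div]
  gcongr
  linarith [Real.add_one_le_exp x]

section

variable {lam q : ℝ} {m : ℕ}

theorem exp_mul_exp_neg_le_div {a x : ℝ} (hlam : 0 < lam) (hq : 80 * (1 + lam) ^ 4 ≤ q)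
    (ha : a ≤ 19) (hx : q ^ 2 / 20 ≤ x) :
    Real.exp (a * lam ^ 2) * Real.exp (-x) ≤ (1 + lam) ^ 4 / q := by
  have h_one : 1 ≤ (1 + lam) ^ 4 := one_le_pow₀ (by linarith)
  have h_sq : lam ^ 2 ≤ (1 + lam) ^ 4 := by nlinarith [mul_pos hlam hlam]
  have hq_pos : 0 < q := by linarith
  calc _ ≤ Real.exp (-q) := by
        rw [← Real.exp_add, Real.exp_le_exp]
        nlinarith [h_sq, mul_le_mul_of_nonneg_right ha (sq_nonneg lam)]
    _ ≤ 1 / q := exp_neg_le_one_div hq_pos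
    _ ≤ _ := by gcongr

theorem norm_simpleFactor_mul_exp_sub_one_le_of_near {x : ℝ} (hlam : 0 < lam)
    (hq : 80 * (1 + lam) ^ 4 ≤ q) (hqm : q ^ 4 ≤ m) (hx : |x| ≤ 2 / q) :
    ‖simpleFactor m ((lam ^ 2 : ℝ) * exp (x * I)) * Real.exp (lam ^ 2 / 2) - 1‖ ≤
      62 * ((1 + lam) ^ 4 / q) := by
  have h_one : 1 ≤ (1 + lam) ^ 4 := one_le_pow₀ (by linarith)
  have h_sq : lam ^ 2 ≤ (1 + lam) ^ 4 := by nlinarith [mul_pos hlam hlam]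
  have h_four : (lam ^ 2) ^ 2 ≤ (1 + lam) ^ 4 := by
    rw [← pow_mul]
    gcongr
    linarith
  have hq_pos : 0 < q := by linarith
  have hq_le : q ≤ m := (le_self_pow₀ (by linarith) (by norm_num)).trans hqm
  have hm : (0 : ℝ) < m := hq_pos.trans_le hq_le
  have h_small : (1 + lam) ^ 4 / q ≤ 1 / 80 := by
    rw [div_le_iff₀ hq_pos]
    linarith
  have hρ_m : lam ^ 2 / m ≤ (1 + lam) ^ 4 / q := by gcongr
  have h_near := norm_simpleFactor_mul_exp_sub_one_le (Nat.cast_pos.1 hm) (ρ := lam ^ 2)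
    (α := 2 / q) (δ := 1 / q) (D := 23 * ((1 + lam) ^ 4 / q)) (by positivity) (by positivity)
    (by rw [div_le_iff₀ hq_pos]; linarith)
    (by rw [← mul_div_assoc, ← add_div, div_le_iff₀ hq_pos]; linarith)
    (by rw [mul_div_assoc]; linarith)
    (by
      calc _ = 5 * (lam ^ 2 / q) + 2 * (lam ^ 2 / m) + 16 * ((lam ^ 2) ^ 2 / m) := by
            field_simp
            ring
        _ ≤ 5 * ((1 + lam) ^ 4 / q) + 2 * ((1 + lam) ^ 4 / q) + 16 * ((1 + lam) ^ 4 / q) := by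
            gcongr
        _ = _ := by ring)
    (by linarith) ((norm_ofReal_mul_exp_mul_I_sub_le (by positivity) x).trans (by gcongr))
  have h_exp := exp_mul_exp_neg_le_div hlam hq le_rfl (x := m * (1 / q) ^ 2 / 4) (by
    calc q ^ 2 / 20 ≤ q ^ 4 * (1 / q) ^ 2 / 4 := by
          field_simp
          norm_num
      _ ≤ _ := by gcongr)
  linarith

theorem sq_div_le_of_far {φ ψ : ℝ} (hq : 0 < q) (hφψ : 1 / q < |φ| ∨ 1 / q < |ψ|) :
    q ^ 2 / 20 ≤ q ^ 4 / (2 * π ^ 2) * (φ ^ 2 + ψ ^ 2) := by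
  have h_dist : (1 / q) ^ 2 ≤ φ ^ 2 + ψ ^ 2 := by
    rw [← sq_abs φ, ← sq_abs ψ]
    rcases hφψ with h | h
    · exact (pow_le_pow_left₀ (by positivity) h.le 2).trans (le_add_of_nonneg_right (by positivity))
    · exact (pow_le_pow_left₀ (by positivity) h.le 2).trans (le_add_of_nonneg_left (by positivity))
  have hpi : 2 * π ^ 2 ≤ 20 := by nlinarith [Real.pi_lt_d2, Real.pi_pos]
  calc q ^ 2 / 20 = q ^ 4 / 20 * (1 / q) ^ 2 := by field_simp
    _ ≤ _ := by gcongr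

theorem norm_chi_mul_simpleFactor_sub_one_le {n : ℕ} {φ ψ : ℝ} (hlam : 0 < lam)
    (hq : 80 * (1 + lam) ^ 4 ≤ q) (hqm : q ^ 4 ≤ m) (hqn : q ^ 4 = n * lam)
    (hφ : |φ| ≤ π) (hψ : |ψ| ≤ π) :
    ‖chi lam φ ^ n * chi lam ψ ^ n *
      (simpleFactor m ((lam ^ 2 : ℝ) * exp ((φ + ψ : ℝ) * I)) * Real.exp (lam ^ 2 / 2) - 1)‖ ≤
      62 * ((1 + lam) ^ 4 / q) * Real.exp (-(q ^ 4 / (2 * π ^ 2) * (φ ^ 2 + ψ ^ 2))) := by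
  set G := Real.exp (-(q ^ 4 / (2 * π ^ 2) * (φ ^ 2 + ψ ^ 2))) with hG
  have h_one : 1 ≤ (1 + lam) ^ 4 := one_le_pow₀ (by linarith)
  have hq_pos : 0 < q := by linarith
  have : 0 < G := Real.exp_pos _
  have hG_le : G ≤ 1 := Real.exp_le_one_iff.2 (neg_nonpos.2 (by positivity))
  have h_chi : ‖chi lam φ ^ n * chi lam ψ ^ n‖ ≤ G * G := by
    refine (norm_chi_pow_mul_chi_pow_le hlam hφ hψ n).trans_eq ?_
    rw [hG, ← Real.exp_add, ← hqn]
    ring_nf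
  rw [norm_mul]
  by_cases h_near : |φ| ≤ 1 / q ∧ |ψ| ≤ 1 / q
  · have h_sum : |φ + ψ| ≤ 2 / q := by
      calc _ ≤ 1 / q + 1 / q := (abs_add_le _ _).trans (add_le_add h_near.1 h_near.2)
        _ = _ := by ring
    calc _ ≤ G * 1 * (62 * ((1 + lam) ^ 4 / q)) := by
          gcongr
          · exact h_chi.trans (by gcongr)
          · exact norm_simpleFactor_mul_exp_sub_one_le_of_near hlam hq hqm h_sum
      _ = _ := by ring
  · have h_far : 1 / q < |φ| ∨ 1 / q < |ψ| := by
      rwa [not_and_or, not_le, not_le] at h_near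
    have hm : 0 < m := Nat.cast_pos.1 ((pow_pos hq_pos 4).trans_le hqm)
    have h_factor := norm_simpleFactor_mul_exp_sub_one_le_exp hm
      ((lam ^ 2 : ℝ) * exp ((φ + ψ : ℝ) * I))
    rw [norm_ofReal_mul_exp_mul_I (by positivity)] at h_factor
    calc _ ≤ G * G * (2 * Real.exp (6 * lam ^ 2)) := by gcongr
      _ = 2 * (Real.exp (6 * lam ^ 2) * G) * G := by ring
      _ ≤ 62 * ((1 + lam) ^ 4 / q) * G := by
          gcongr
          · norm_num
          · exact exp_mul_exp_neg_le_div hlam hq (by norm_num) (sq_div_le_of_far hq_pos h_far)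

end

theorem integrable_circleMeasure_prod {E : Type*} [NormedAddCommGroup E] {f : ℝ × ℝ → E}
    (hf : Continuous f) :
    Integrable f (circleMeasure.prod circleMeasure) := by
  rw [circleMeasure, Measure.prod_restrict]
  exact (hf.continuousOn.integrableOn_compact (isCompact_Icc.prod isCompact_Icc)).mono_set
    (Set.prod_mono Set.Ioc_subset_Icc_self Set.Ioc_subset_Icc_self)

theorem ae_circleMeasure_prod :
    ∀ᵐ p ∂(circleMeasure.prod circleMeasure), |p.1| ≤ π ∧ |p.2| ≤ π := by
  rw [circleMeasure, Measure.prod_restrict]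
  refine ae_restrict_of_forall_mem (measurableSet_Ioc.prod measurableSet_Ioc) fun p hp => ?_
  exact ⟨abs_le.2 ⟨hp.1.1.le, hp.1.2⟩, abs_le.2 ⟨hp.2.1.le, hp.2.2⟩⟩

theorem integral_exp_neg_mul_circleMeasure_prod_le {b : ℝ} (hb : 0 < b) :
    ∫ p : ℝ × ℝ, Real.exp (-(b * (p.1 ^ 2 + p.2 ^ 2))) ∂(circleMeasure.prod circleMeasure) ≤
      π / b := by
  have h_le : ∫ x, Real.exp (-b * x ^ 2) ∂circleMeasure ≤ √(π / b) := by
    rw [← integral_gaussian]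
    exact setIntegral_le_integral (integrable_exp_neg_mul_sq hb)
      (ae_of_all _ fun x => (Real.exp_pos _).le)
  have : 0 ≤ ∫ x, Real.exp (-b * x ^ 2) ∂circleMeasure :=
    integral_nonneg fun x => (Real.exp_pos _).le
  calc _ = (∫ x, Real.exp (-b * x ^ 2) ∂circleMeasure) *
        ∫ x, Real.exp (-b * x ^ 2) ∂circleMeasure := by
        rw [← integral_prod_mul]
        congr 1 with p
        rw [← Real.exp_add]
        ring_nf
    _ ≤ √(π / b) * √(π / b) := by gcongr
    _ = π / b := Real.mul_self_sqrt (by positivity)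

end DoubleIntegral

/-! ### The relative error of the formula -/

section RelativeError

open MeasureTheory Complex Filter
open scoped Real

theorem sq_integral_circleMeasure (f : ℝ → ℂ) :
    (∫ φ, f φ ∂circleMeasure) ^ 2 =
      ∫ p : ℝ × ℝ, f p.1 * f p.2 ∂(circleMeasure.prod circleMeasure) := by
  rw [sq, integral_prod_mul]

theorem norm_integral_mul_exp_sub_sq_le {lam q : ℝ} {n m : ℕ} (hlam : 0 < lam)
    (hq : 80 * (1 + lam) ^ 4 ≤ q) (hqm : q ^ 4 ≤ m) (hqn : q ^ 4 = n * lam) :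
    ‖(∫ p : ℝ × ℝ, chi lam p.1 ^ n * chi lam p.2 ^ n * exp (-(m * (p.1 + p.2) * I)) *
        simpleFactor m (lam ^ 2 * exp ((p.1 + p.2) * I)) ∂(circleMeasure.prod circleMeasure)) *
          Real.exp (lam ^ 2 / 2) -
        (∫ φ, chi lam φ ^ n * exp (-(m * φ * I)) ∂circleMeasure) ^ 2‖ ≤
      62 * ((1 + lam) ^ 4 / q) * (2 * π ^ 3 / q ^ 4) := by
  have hq_pos : 0 < q := by
    have := one_le_pow₀ (n := 4) (by linarith : 1 ≤ 1 + lam)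
    linarith
  rw [sq_integral_circleMeasure, ← integral_mul_const, ← integral_sub]
  · refine (norm_integral_le_of_norm_le ((integrable_circleMeasure_prod
      (f := fun p => Real.exp (-(q ^ 4 / (2 * π ^ 2) * (p.1 ^ 2 + p.2 ^ 2))))
      (by fun_prop)).const_mul (62 * ((1 + lam) ^ 4 / q))) ?_).trans ?_
    · filter_upwards [ae_circleMeasure_prod] with p hp
      refine le_of_eq_of_le ?_ (norm_chi_mul_simpleFactor_sub_one_le hlam hq hqm hqn hp.1 hp.2)
      refine Eq.trans ?_ (norm_mul_exp_neg_mul_I _ m (p.1 + p.2))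
      push_cast
      rw [show -(m * (p.1 + p.2) * I : ℂ) = -(m * p.1 * I) + -(m * p.2 * I) by ring, exp_add]
      ring_nf
    · rw [integral_const_mul]
      gcongr
      refine (integral_exp_neg_mul_circleMeasure_prod_le (by positivity)).trans_eq ?_
      field_simp
  · exact integrable_circleMeasure_prod (by fun_prop)
  · exact integrable_circleMeasure_prod (by fun_prop)

theorem mul_exp_div_pow {n : ℕ} (hn : (n : ℝ) ≠ 0) (m : ℕ) (z : ℂ) (φ : ℝ) :
    (z * exp (-(((m : ℝ) / n : ℝ) * φ * I))) ^ n = z ^ n * exp (-(m * φ * I)) := by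
  have hn' : (n : ℂ) ≠ 0 := by exact_mod_cast hn
  rw [mul_pow, ← exp_nat_mul]
  push_cast
  field_simp

section

variable {n m : ℕ} {lam q : ℝ}

theorem IsParam.natCast_pos (h : IsParam ((m : ℝ) / n) lam) : (0 : ℝ) < n := by
  rcases n.eq_zero_or_pos with rfl | hn
  · have := h.one_lt
    norm_num at this
  · exact Nat.cast_pos.2 hn

theorem IsParam.ncard_div_formula_eq (h : IsParam ((m : ℝ) / n) lam) :
    (((dicores n m).ncard / formula n m lam : ℝ) : ℂ) =
      (∫ p : ℝ × ℝ, chi lam p.1 ^ n * chi lam p.2 ^ n * exp (-(m * (p.1 + p.2) * I)) *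
        simpleFactor m (lam ^ 2 * exp ((p.1 + p.2) * I)) ∂(circleMeasure.prod circleMeasure)) *
          Real.exp (lam ^ 2 / 2) *
        (n * ((m : ℝ) / n * (1 + lam - m / n)) / (2 * π) : ℝ) := by
  have hlam := h.1
  have hn := h.natCast_pos
  have hE := exp_sub_one_pos hlam
  rw [← ncard_dicores_eq_integral hlam]
  norm_cast
  rw [formula, neg_div, Real.exp_neg, mul_assoc (2 * π * n)]
  field_simp

theorem norm_div_sq_sub_one_le {P : ℂ} {S t : ℝ} (hS : 0 < S) (ht : t ≤ 1)
    (h : ‖P - S‖ ≤ t * S) : ‖P ^ 2 / (S ^ 2 : ℝ) - 1‖ ≤ 3 * t := by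
  have hS' : (S : ℂ) ≠ 0 := ofReal_ne_zero.2 hS.ne'
  have h_rel : ‖P / S - 1‖ ≤ t := by
    rwa [div_sub_one hS', norm_div, norm_real, Real.norm_of_nonneg hS.le, div_le_iff₀ hS]
  calc ‖P ^ 2 / (S ^ 2 : ℝ) - 1‖ = ‖P / S - 1‖ * ‖(P / S - 1) + 2‖ := by
        rw [← norm_mul, ofReal_pow]
        ring_nf
    _ ≤ t * (t + 2) := by
        gcongr
        · exact (norm_nonneg _).trans h_rel
        · exact (norm_add_le _ _).trans (by simpa using h_rel)
    _ ≤ 3 * t := by nlinarith [(norm_nonneg _).trans h_rel]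

theorem IsParam.one_div_sq_le_sqrt {c : ℝ} (h : IsParam c lam) (hn : 0 < n)
    (hqn : q ^ 4 = n * lam) : 1 / q ^ 2 ≤ √(π / (n * (c * (1 + lam - c)) / 2)) := by
  have hlam := h.1
  have hv_pos : 0 < c * (1 + lam - c) := by linarith [h.half_le_variance]
  refine Real.le_sqrt_of_sq_le ?_
  calc (1 / q ^ 2) ^ 2 = 1 / (n * lam) := by rw [← hqn]; ring
    _ ≤ 1 / (n * (c * (1 + lam - c))) := by gcongr; exact h.variance_le
    _ ≤ π / (n * (c * (1 + lam - c)) / 2) := by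
        gcongr
        · linarith [Real.pi_gt_three]
        · exact half_le_self (by positivity)

theorem IsParam.norm_integral_sq_mul_sub_one_le (h : IsParam ((m : ℝ) / n) lam)
    (hq : 80 * (1 + lam) ^ 4 ≤ q) (hqn : q ^ 4 = n * lam) :
    ‖(∫ φ, chi lam φ ^ n * exp (-(m * φ * I)) ∂circleMeasure) ^ 2 *
        (n * ((m : ℝ) / n * (1 + lam - m / n)) / (2 * π) : ℝ) - 1‖ ≤
      135 * ((1 + lam) ^ 4 / q) := by
  have hlam := h.1
  have hn := h.natCast_pos
  have h_one : 1 ≤ (1 + lam) ^ 4 := one_le_pow₀ (by linarith)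
  have hq_large : 80 ≤ q := by linarith
  have hq_le : q ≤ n * lam := (le_self_pow₀ (by linarith) (by norm_num)).trans_eq hqn
  have hn_two : 2 * lam ≤ n * lam := by nlinarith [mul_pos hlam hlam]
  have h_local := h.norm_integral_chi_pow_sub_le
    (Nat.ofNat_le_cast.1 (le_of_mul_le_mul_right hn_two hlam)) (by linarith)
  set v := (m : ℝ) / n * (1 + lam - m / n)
  have hv_pos : 0 < v := by linarith [h.half_le_variance]
  set S := √(π / (n * v / 2))
  have hS_sq : S ^ 2 = π / (n * v / 2) := Real.sq_sqrt (by positivity)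
  have hS : 1 / q ^ 2 ≤ S := h.one_div_sq_le_sqrt (Nat.cast_pos.1 hn) hqn
  have hpi : π ^ 4 ≤ 99 := (pow_le_pow_left₀ Real.pi_pos.le Real.pi_lt_d2.le 4).trans (by norm_num)
  have h_dist : 36 * π ^ 4 * ((1 + lam) ^ 2 / (n * lam)) ≤ 45 * ((1 + lam) ^ 4 / q) * S := by
    calc _ ≤ 36 * 99 * ((1 + lam) ^ 4 / q ^ 4) := by
          rw [hqn]
          gcongr <;> linarith
      _ = 36 * 99 / q * ((1 + lam) ^ 4 / q) * (1 / q ^ 2) := by ring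
      _ ≤ 45 * ((1 + lam) ^ 4 / q) * S := by
          gcongr
          rw [div_le_iff₀ (by linarith)]
          linarith
  have h_inv : n * v / (2 * π) = (S ^ 2)⁻¹ := by
    rw [hS_sq]
    field_simp
  simp only [← mul_exp_div_pow hn.ne']
  rw [h_inv, ofReal_inv, ← div_eq_mul_inv]
  refine (norm_div_sq_sub_one_le (by positivity) ?_ (h_local.trans h_dist)).trans_eq (by ring)
  rw [← mul_div_assoc, div_le_one (by linarith)]
  linarith

theorem IsParam.abs_ncard_div_formula_sub_one_le (h : IsParam ((m : ℝ) / n) lam)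
    (hq : 80 * (1 + lam) ^ 4 ≤ q) (hqn : q ^ 4 = n * lam) :
    |((dicores n m).ncard : ℝ) / formula n m lam - 1| ≤ 800 * ((1 + lam) ^ 4 / q) := by
  have hlam := h.1
  have hn := h.natCast_pos
  have hq_pos : 0 < q := by
    have := one_le_pow₀ (n := 4) (by linarith : 1 ≤ 1 + lam)
    linarith
  have hqm : q ^ 4 ≤ m := by
    rw [hqn, ← le_div_iff₀' hn]
    exact h.lt.le
  set v := n * ((m : ℝ) / n * (1 + lam - m / n)) with hv
  have hv_nonneg : 0 ≤ v := mul_nonneg hn.le (by linarith [h.half_le_variance])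
  have hv_le : v ≤ q ^ 4 := by
    rw [hqn]
    exact mul_le_mul_of_nonneg_left h.variance_le hn.le
  have h_sq := h.norm_integral_sq_mul_sub_one_le hq hqn
  have h_simple := norm_integral_mul_exp_sub_sq_le hlam hq hqm hqn
  rw [← Real.norm_eq_abs, ← norm_real, ofReal_sub, ofReal_one, h.ncard_div_formula_eq, ← hv]
  set P := ∫ φ, chi lam φ ^ n * exp (-(m * φ * I)) ∂circleMeasure
  have hpi : π ^ 2 ≤ 10 := by nlinarith [Real.pi_lt_d2, Real.pi_pos]
  refine (norm_sub_le_norm_sub_add_norm_sub _ (P ^ 2 * (v / (2 * π) : ℝ)) _).trans ?_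
  rw [← sub_mul, norm_mul, norm_real, Real.norm_of_nonneg (by positivity)]
  calc _ ≤ 62 * ((1 + lam) ^ 4 / q) * (2 * π ^ 3 / q ^ 4) * (q ^ 4 / (2 * π)) +
        135 * ((1 + lam) ^ 4 / q) := by gcongr
    _ = (62 * π ^ 2 + 135) * ((1 + lam) ^ 4 / q) := by
        field_simp
    _ ≤ _ := by
        gcongr
        linarith

theorem IsParam.exists_pow_four_eq {M : ℝ} (h : IsParam ((m : ℝ) / n) lam) (hM : 0 ≤ M)
    (hm : (16 * M) ^ 4 * ((m : ℝ) / n) ^ 16 ≤ m - n) :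
    ∃ q : ℝ, q ^ 4 = n * lam ∧ M * (1 + lam) ^ 4 ≤ q := by
  have hlam := h.1
  have hn := h.natCast_pos
  have hq : √√(n * lam) ^ 4 = n * lam := by
    rw [pow_mul _ 2 2, Real.sq_sqrt (by positivity), Real.sq_sqrt (by positivity)]
  have h_sub : (m : ℝ) - n ≤ n * lam := by linarith [(div_le_iff₀ hn).1 h.le_one_add]
  refine ⟨√√(n * lam), hq, ?_⟩
  calc M * (1 + lam) ^ 4 ≤ M * (2 * ((m : ℝ) / n)) ^ 4 := by
        gcongr
        linarith [h.one_lt, h.lt]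
    _ = 16 * M * ((m : ℝ) / n) ^ 4 := by ring
    _ ≤ _ := by
        rw [← pow_le_pow_iff_left₀ (by positivity) (by positivity) four_ne_zero, hq]
        linarith

end

theorem exists_forall_mul_pow_le (C K : ℝ) : ∃ N R : ℕ, ∀ n m : ℕ, N ≤ n → n + R ≤ m →
    (m : ℝ) ≤ C * (n * Real.log n) → K * ((m : ℝ) / n) ^ 16 ≤ m - n := by
  have h_log : ∀ᶠ x : ℝ in atTop, |K| * (C * Real.log x) ^ 16 ≤ x := by
    have h_little := (Real.isLittleO_pow_log_id_atTop (n := 16)).const_mul_left (|K| * C ^ 16)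
    filter_upwards [h_little.bound one_pos, eventually_ge_atTop 0] with x hx hx_nonneg
    rw [one_mul, id, Real.norm_of_nonneg hx_nonneg] at hx
    rw [mul_pow, ← mul_assoc]
    exact (le_abs_self _).trans hx
  obtain ⟨N, hN⟩ := eventually_atTop.1 (tendsto_natCast_atTop_atTop.eventually h_log)
  obtain ⟨R, hR⟩ := exists_nat_ge (|K| * 2 ^ 16)
  refine ⟨max N 1, R, fun n m hn hm h_le => ?_⟩
  have hn_pos : (0 : ℝ) < n := Nat.cast_pos.2 ((le_max_right N 1).trans hn)
  have hm' : (n : ℝ) + R ≤ m := by exact_mod_cast hm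
  rcases le_total (m : ℝ) (2 * n) with h_two | h_two
  · calc (K * ((m : ℝ) / n) ^ 16 : ℝ) ≤ |K| * 2 ^ 16 := by
          gcongr
          · exact le_abs_self K
          · rwa [div_le_iff₀ hn_pos]
      _ ≤ m - n := by linarith
  · calc (K * ((m : ℝ) / n) ^ 16 : ℝ) ≤ |K| * (C * Real.log n) ^ 16 := by
          gcongr
          · exact le_abs_self K
          · rw [div_le_iff₀ hn_pos]
            linarith
      _ ≤ n := hN n ((le_max_left N 1).trans hn)
      _ ≤ m - n := by linarith

end RelativeError

end Dicore

theorem theorem2_general :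
    (∀ c : ℝ, 1 < c → ∃! lam : ℝ, Dicore.IsParam c lam) ∧
    ∀ ε : ℝ, 0 < ε → ∃ K : ℝ, ∀ n m : ℕ, K * ((m : ℝ) / n) ^ 16 ≤ m - n →
      ∀ lam : ℝ, Dicore.IsParam ((m : ℝ) / n) lam →
        |((Dicore.dicores n m).ncard : ℝ) / Dicore.formula n m lam - 1| < ε := by
  refine ⟨fun c hc => Dicore.existsUnique_isParam hc, fun ε hε => ?_⟩
  refine ⟨(16 * (80 + 801 / ε)) ^ 4, fun n m hm lam h => ?_⟩
  obtain ⟨q, hqn, hq⟩ := h.exists_pow_four_eq (by positivity) hm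
  have hlam := h.1
  have h_pow : 0 < (1 + lam) ^ 4 := by positivity
  have h_error : 0 ≤ 801 / ε * (1 + lam) ^ 4 := by positivity
  refine (h.abs_ncard_div_formula_sub_one_le (by linarith) hqn).trans_lt ?_
  have hq_pos : 0 < q := by linarith
  rw [← mul_div_assoc, div_lt_iff₀ hq_pos]
  calc 800 * (1 + lam) ^ 4 < ε * (801 / ε * (1 + lam) ^ 4) := by
        field_simp
        linarith
    _ ≤ ε * q := by
        gcongr
        linarith

/-- For `c > 1` the parameter is well defined; and for all `C, ε > 0` there are thresholds `N, R`
such that the ratio of the number of dicores to the formula is within `ε` of `1` for all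
`n ≥ N` and all `m` with `m - n ≥ R` and `m ≤ C n log n`. -/
theorem theorem2 :
    (∀ c : ℝ, 1 < c → ∃! lam : ℝ, Dicore.IsParam c lam) ∧
    ∀ C : ℝ, 0 < C → ∀ ε : ℝ, 0 < ε → ∃ N R : ℕ, ∀ n m : ℕ, N ≤ n → n + R ≤ m →
      (m : ℝ) ≤ C * (n * Real.log n) →
      ∀ lam : ℝ, Dicore.IsParam ((m : ℝ) / n) lam →
        |((Dicore.dicores n m).ncard : ℝ) / Dicore.formula n m lam - 1| < ε := by
  refine ⟨theorem2_general.1, fun C _ ε hε => ?_⟩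
  obtain ⟨K, hK⟩ := theorem2_general.2 ε hε
  obtain ⟨N, R, hNR⟩ := Dicore.exists_forall_mul_pow_le C K
  exact ⟨N, R, fun n m hn hm hlog => hK n m (hNR n m hn hm hlog)⟩
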